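/- Let $n\ge 2$. Let $\mathbb R^{1,n+1}$ be $\mathbb R\times\mathbb R^{n+1}$ with the Minkowski form $\langle \bar x,\bar y\rangle=-x_0y_0+\sum_{i=1}^{n+1}x_iy_i$, let $\mathbb H^{n+1}=\{\langle \bar x,\bar x\rangle=-1,\ x_0>0\}$ and $\mathbb S^{1,n}=\{\langle \bar x,\bar x\rangle=1\}$, and let $\mathbb S^n\subset\mathbb R^{n+1}$ be the unit sphere with its round metric $g_{\mathbb S^n}$, regarded as the boundary at infinity of $\mathbb H^{n+1}$ through the Poincaré ball model $\bar x\mapsto (x_1,\dots,x_{n+1})/(1+x_0)$. An embedding below means a smooth immersion that is a homeomorphism onto its image. (a) Let $\phi:M^n\to\mathbb H^{n+1}$ be a smooth immersion of a smooth $n$-manifold, with smooth unit normal field $\eta:M^n\to\mathbb S^{1,n}$ (tangent to $\mathbb H^{n+1}$ and orthogonal to the hypersurface). The principal curvatures at $p$ are the numbers $\kappa$ with $d\eta_p(v)=-\kappa\,d\phi_p(v)$ for some nonzero $v\in T_pM$. The hyperbolic Gauss map $G:M\to\mathbb S^n$ is defined by $\phi-\eta=\psi_0\,(1,G)$ with $\psi_0>0$.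 Suppose that the metric induced by $\phi$ on $M$ is complete, that there is a constant $\kappa_0>-1$ such that all principal curvatures at all points are $\ge\kappa_0$, and that $G$ is injective. (In particular, this holds for every admissible hypersurface, that is, if moreover $\phi$ is proper.) Suppose that the boundary at infinity $\partial_\infty\phi(M)$, the set of points of $\mathbb S^n$ in the closure of the image of $\phi$ in the closed Poincaré ball, is a disjoint finite union of smooth compact embedded submanifolds without boundary of $\mathbb S^n$ (possibly of different dimensions, possibly none). Then there is $t_0\in\mathbb R$ such that for every $t\ge t_0$ the map $$\phi^t=\exp_{\phi}(-t\eta)=\phi\cosh t-\eta\sinh t:M\to\mathbb H^{n+1}$$ of the geodesic normal flow is an embedding. (b) Let $\Omega\subset\mathbb S^n$ be open, let $\rho:\Omega\to\mathbb R$ be smooth, and suppose that $\hat g=e^{2\rho}g_{\mathbb S^n}$ is a realizable metric: $\hat g$ is complete on $\Omega$, and the symmetric 2-tensor $$P=-\nabla^2\rho+d\rho\otimes d\rho-\tfrac12\bigl(|\nabla\rho|^2-1\bigr)g_{\mathbb S^n}$$ (gradient, Hessian and norm with respect to $g_{\mathbb S^n}$) is bounded with respect to $\hat g$. Suppose that $\partial\Omega$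 is a disjoint finite union of smooth compact embedded submanifolds without boundary of $\mathbb S^n$, as in (a). Then there is $t_0\in\mathbb R$ such that for every $t\ge t_0$ the map $$\phi^t(x)=\frac{e^{\rho+t}}2\Bigl(1+e^{-2(\rho+t)}\bigl(1+|\nabla\rho|^2\bigr)\Bigr)(1,x)+e^{-(\rho+t)}(0,-x+\nabla\rho):\Omega\to\mathbb H^{n+1}$$ is an embedding. -/

import Mathlib

open Set Filter Topology
open scoped Manifold ContDiff ENNReal

noncomputable section

namespace HypFlow

/-- The unit round sphere `S^n` in `ℝ^{n+1}`, with Mathlib's smooth structure. -/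
abbrev Sph (n : ℕ) : Type := Metric.sphere (0 : EuclideanSpace ℝ (Fin (n + 1))) 1

/-- The vector space underlying Minkowski space `ℝ^{1,n+1}`, written as time times space. -/
abbrev Mink (n : ℕ) : Type := ℝ × EuclideanSpace ℝ (Fin (n + 1))

/-- The Minkowski form `-x₀ y₀ + ∑ xᵢ yᵢ`. -/
def mink {n : ℕ} (x y : Mink n) : ℝ := -(x.1 * y.1) + inner ℝ x.2 y.2

/-- Hyperbolic space `ℍ^{n+1}`: the upper sheet of the hyperboloid. -/
def hyp (n : ℕ) : Set (Mink n) := {x | mink x x = -1 ∧ 0 < x.1}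

/-- The stereographic projection `(x₀, x') ↦ x' / (1 + x₀)` of the hyperboloid
onto the open unit ball (the Poincaré model). -/
def toBall {n : ℕ} (x : Mink n) : EuclideanSpace ℝ (Fin (n + 1)) := (1 + x.1)⁻¹ • x.2

section Manifolds

variable {n : ℕ} {M : Type*} [TopologicalSpace M] [ChartedSpace (EuclideanSpace ℝ (Fin n)) M]

/-- The differential at `p` of a map from `M` to Minkowski space. -/
def dMink (φ : M → Mink n) (p : M) : TangentSpace (𝓡 n) p →L[ℝ] Mink n :=
  mfderiv (𝓡 n) 𝓘(ℝ, Mink n) φ p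

/-- Completeness of the Riemannian metric on `M` whose norm on the tangent space at `p` is `N p`:
every Cauchy sequence for the associated distance (the infimum of the lengths of `C^1` paths)
converges in `M`. -/
def IsCompleteMetric (N : ∀ p : M, TangentSpace (𝓡 n) p → ℝ) : Prop :=
  letI : ∀ p : M, ENorm (TangentSpace (𝓡 n) p) := fun p => ⟨fun v => ENNReal.ofReal (N p v)⟩
  ∀ u : ℕ → M,
    (∀ ε : ℝ≥0∞, 0 < ε → ∃ k₀ : ℕ, ∀ k ≥ k₀, ∀ l ≥ k₀,
      Manifold.riemannianEDist (𝓡 n) (u k) (u l) < ε) →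
    ∃ p : M, Tendsto u atTop (𝓝 p)

/-- `φ : M → ℍ^{n+1}` is a smooth immersion. -/
structure IsImmersedHyp (φ : M → Mink n) : Prop where
  mem : ∀ p, φ p ∈ hyp n
  smooth : ContMDiff (𝓡 n) 𝓘(ℝ, Mink n) ∞ φ
  immersion : ∀ p, Function.Injective (dMink φ p)

/-- `φ : M → ℍ^{n+1}` is a smooth embedding: an immersion that is a homeomorphism
onto its image. -/
structure IsEmbeddedHyp (φ : M → Mink n) : Prop extends IsImmersedHyp φ where
  embedding : IsEmbedding φ

/-- `η : M → S^{1,n}` is a smooth unit normal field along `φ : M → ℍ^{n+1}`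
(tangent to `ℍ^{n+1}` and normal to the hypersurface). -/
structure IsUnitNormal (φ η : M → Mink n) : Prop where
  smooth : ContMDiff (𝓡 n) 𝓘(ℝ, Mink n) ∞ η
  unit : ∀ p, mink (η p) (η p) = 1
  tangent : ∀ p, mink (η p) (φ p) = 0
  normal : ∀ p v, mink (η p) (dMink φ p v) = 0

/-- The norm of the first fundamental form, i.e. of the metric induced by `φ`. -/
def inducedNorm (φ : M → Mink n) (p : M) (v : TangentSpace (𝓡 n) p) : ℝ :=
  Real.sqrt (mink (dMink φ p v) (dMink φ p v))

/-- `κ` is a principal curvature at `p`: an eigenvalue of the shape operator `S`, where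
`dη = -dφ ∘ S`. With this sign `⟨dψ(eᵢ), dψ(eⱼ)⟩ = (1 + κᵢ)² δᵢⱼ` for `ψ = φ - η`. -/
def IsPrincipalCurvature (φ η : M → Mink n) (p : M) (κ : ℝ) : Prop :=
  ∃ v : TangentSpace (𝓡 n) p, v ≠ 0 ∧ dMink η p v = -(κ • dMink φ p v)

/-- Uniform weak horospherical convexity. -/
def IsUniformlyWeaklyHoroConvex (φ η : M → Mink n) : Prop :=
  ∃ κ₀ : ℝ, -1 < κ₀ ∧ ∀ p κ, IsPrincipalCurvature φ η p κ → κ₀ ≤ κ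

/-- The hyperbolic Gauss map `G : M → S^n ⊆ ℝ^{n+1}`, given by `ψ = φ - η = ψ₀ (1, G)` for the
light cone map `ψ`. -/
def gaussMap (φ η : M → Mink n) (p : M) : EuclideanSpace ℝ (Fin (n + 1)) :=
  (φ p - η p).1⁻¹ • (φ p - η p).2

/-- The boundary at infinity `∂_∞ φ(M) ⊆ S^n`: the accumulation set of the hypersurface on the
unit sphere bounding the Poincaré ball. -/
def boundaryAtInfinity (φ : M → Mink n) : Set (Sph n) :=
  {x | (x : EuclideanSpace ℝ (Fin (n + 1))) ∈ closure (range fun p => toBall (φ p))}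

/-- The geodesic normal flow `φ^t = exp_φ(-t η)`. -/
def normalFlow (φ η : M → Mink n) (t : ℝ) (p : M) : Mink n :=
  Real.cosh t • φ p - Real.sinh t • η p

end Manifolds

/-- `N ⊆ S^n` is a smooth embedded submanifold of dimension `d` (without boundary): near each of
its points there is a smooth chart of `S^n` in which `N` is a `d`-dimensional coordinate slice. -/
def IsSubmanifold {n : ℕ} (d : ℕ) (N : Set (Sph n)) : Prop :=
  d ≤ n ∧ ∀ p ∈ N, ∃ e ∈ IsManifold.maximalAtlas (𝓡 n) ∞ (Sph n), p ∈ e.source ∧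
    ∀ x ∈ e.source, x ∈ N ↔ ∀ i : Fin n, d ≤ i.val → e x i = 0

/-- `B ⊆ S^n` is a finite disjoint union of smooth compact embedded submanifolds without boundary
(the dimensions may differ). -/
def IsFiniteUnionOfClosedSubmanifolds {n : ℕ} (B : Set (Sph n)) : Prop :=
  ∃ (k : ℕ) (N : Fin k → Set (Sph n)) (d : Fin k → ℕ),
    (∀ i, IsCompact (N i) ∧ IsSubmanifold (d i) (N i)) ∧
    Pairwise (fun i j => Disjoint (N i) (N j)) ∧ B = ⋃ i, N i

section Conformal

variable {n : ℕ}

/-- The extension of a function on `S^n` to `ℝ^{n+1} ∖ {0}` that is constant on rays. -/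
def radialExt (ρ : Sph n → ℝ) (y : EuclideanSpace ℝ (Fin (n + 1))) : ℝ :=
  open Classical in
  if h : ‖y‖⁻¹ • y ∈ Metric.sphere (0 : EuclideanSpace ℝ (Fin (n + 1))) 1 then ρ ⟨_, h⟩ else 0

/-- The gradient of `ρ` at `x` for the round metric, as a vector of `ℝ^{n+1}`. The Euclidean
gradient of the radially constant extension is orthogonal to `x`, hence is the gradient on
the sphere. -/
def sphGrad (ρ : Sph n → ℝ) (x : Sph n) : EuclideanSpace ℝ (Fin (n + 1)) :=
  gradient (radialExt ρ) (x : EuclideanSpace ℝ (Fin (n + 1)))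

/-- The Hessian `⟨∇_v ∇ρ, w⟩` of `ρ` for the round metric. The Levi-Civita connection of the sphere
is the tangential part of the Euclidean derivative, and taking the tangential part is not needed
in the inner product with a tangent vector `w`. To be used for `v, w` orthogonal to `x`. -/
def sphHess (ρ : Sph n → ℝ) (x : Sph n) (v w : EuclideanSpace ℝ (Fin (n + 1))) : ℝ :=
  inner ℝ (fderiv ℝ (gradient (radialExt ρ)) (x : EuclideanSpace ℝ (Fin (n + 1))) v) w

/-- The 2-tensor `P = -∇²ρ + dρ ⊗ dρ - (|∇ρ|² - 1)/2 g` on tangent vectors of `S^n` at `x`. -/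
def tensorP (ρ : Sph n → ℝ) (x : Sph n) (v w : EuclideanSpace ℝ (Fin (n + 1))) : ℝ :=
  -sphHess ρ x v w + inner ℝ (sphGrad ρ x) v * inner ℝ (sphGrad ρ x) w
    - (1 / 2) * (‖sphGrad ρ x‖ ^ 2 - 1) * inner ℝ v w

/-- The differential at `x` of the inclusion of `Ω ⊆ S^n` into `ℝ^{n+1}`. -/
def dIncl (Ω : TopologicalSpace.Opens (Sph n)) (x : Ω) :
    TangentSpace (𝓡 n) x →L[ℝ] EuclideanSpace ℝ (Fin (n + 1)) :=
  mfderiv (𝓡 n) 𝓘(ℝ, EuclideanSpace ℝ (Fin (n + 1)))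
    (fun y : Ω => ((y : Sph n) : EuclideanSpace ℝ (Fin (n + 1)))) x

/-- The norm of the conformal metric `e^{2ρ} g` on the tangent space of `Ω ⊆ S^n` at `x`. -/
def conformalNorm (Ω : TopologicalSpace.Opens (Sph n)) (ρ : Sph n → ℝ) (x : Ω)
    (v : TangentSpace (𝓡 n) x) : ℝ :=
  Real.exp (ρ x) * ‖dIncl Ω x v‖

/-- The metric `e^{2ρ} g` on `Ω` is realizable: smooth, complete, and with tensor `P` bounded
with respect to this metric. (Only the values of `ρ` on `Ω` matter.) -/
structure IsRealizable (Ω : TopologicalSpace.Opens (Sph n)) (ρ : Sph n → ℝ) : Prop where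
  smooth : ContMDiffOn (𝓡 n) 𝓘(ℝ, ℝ) ∞ ρ (Ω : Set (Sph n))
  complete : IsCompleteMetric (conformalNorm Ω ρ)
  bounded : ∃ C : ℝ, ∀ x ∈ Ω, ∀ v w : EuclideanSpace ℝ (Fin (n + 1)),
    inner ℝ (x : EuclideanSpace ℝ (Fin (n + 1))) v = 0 →
    inner ℝ (x : EuclideanSpace ℝ (Fin (n + 1))) w = 0 →
    |tensorP ρ x v w| ≤ C * (Real.exp (ρ x) * ‖v‖) * (Real.exp (ρ x) * ‖w‖)

/-- The hypersurfaces
`φ^t = e^{ρ+t}/2 (1 + e^{-2(ρ+t)} (1 + |∇ρ|²)) (1, x) + e^{-(ρ+t)} (0, -x + ∇ρ)`. -/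
def conformalFlow (Ω : TopologicalSpace.Opens (Sph n)) (ρ : Sph n → ℝ) (t : ℝ) (x : Ω) : Mink n :=
  (Real.exp (ρ x + t) / 2 * (1 + Real.exp (-2 * (ρ x + t)) * (1 + ‖sphGrad ρ x‖ ^ 2))) •
      ((1, ((x : Sph n) : EuclideanSpace ℝ (Fin (n + 1)))) : Mink n)
    + Real.exp (-(ρ x + t)) •
      ((0, -((x : Sph n) : EuclideanSpace ℝ (Fin (n + 1))) + sphGrad ρ x) : Mink n)

end Conformal

end HypFlow

end

noncomputable section
namespace HypFlow

section MinkowskiAlgebra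

variable {n : ℕ}

lemma mink_comm (x y : Mink n) : mink x y = mink y x := by
  simp only [mink, real_inner_comm, mul_comm]

lemma mink_add_left (x y z : Mink n) : mink (x + y) z = mink x z + mink y z := by
  simp only [mink, Prod.fst_add, Prod.snd_add, inner_add_left]; ring

lemma mink_add_right (x y z : Mink n) : mink x (y + z) = mink x y + mink x z := by
  simp only [mink, Prod.fst_add, Prod.snd_add, inner_add_right]; ring

lemma mink_sub_left (x y z : Mink n) : mink (x - y) z = mink x z - mink y z := by
  simp only [mink, Prod.fst_sub, Prod.snd_sub, inner_sub_left]; ring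

lemma mink_sub_right (x y z : Mink n) : mink x (y - z) = mink x y - mink x z := by
  simp only [mink, Prod.fst_sub, Prod.snd_sub, inner_sub_right]; ring

lemma mink_smul_left (c : ℝ) (x y : Mink n) : mink (c • x) y = c * mink x y := by
  simp only [mink, Prod.smul_fst, Prod.smul_snd, real_inner_smul_left, smul_eq_mul]; ring

lemma mink_smul_right (c : ℝ) (x y : Mink n) : mink x (c • y) = c * mink x y := by
  simp only [mink, Prod.smul_fst, Prod.smul_snd, real_inner_smul_right, smul_eq_mul]; ring

lemma mink_neg_left (x y : Mink n) : mink (-x) y = -mink x y := by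
  simp only [mink, Prod.fst_neg, Prod.snd_neg, inner_neg_left]; ring

lemma mink_neg_right (x y : Mink n) : mink x (-y) = -mink x y := by
  simp only [mink, Prod.fst_neg, Prod.snd_neg, inner_neg_right]; ring

lemma mink_zero_left (x : Mink n) : mink 0 x = 0 := by simp [mink]

lemma mink_zero_right (x : Mink n) : mink x 0 = 0 := by simp [mink]

lemma mink_self (x : Mink n) : mink x x = ‖x.2‖ ^ 2 - x.1 ^ 2 := by
  simp only [mink, real_inner_self_eq_norm_sq]; ring

/-- The Minkowski form as a continuous bilinear map. -/
def minkL (n : ℕ) : Mink n →L[ℝ] Mink n →L[ℝ] ℝ :=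
  -((ContinuousLinearMap.mul ℝ ℝ).bilinearComp (ContinuousLinearMap.fst ℝ _ _)
      (ContinuousLinearMap.fst ℝ _ _)) +
    (innerSL ℝ).bilinearComp (ContinuousLinearMap.snd ℝ ℝ (EuclideanSpace ℝ (Fin (n + 1))))
      (ContinuousLinearMap.snd ℝ ℝ (EuclideanSpace ℝ (Fin (n + 1))))

lemma minkL_apply (x y : Mink n) : minkL n x y = mink x y := by
  simp [minkL, mink, ContinuousLinearMap.bilinearComp_apply]

lemma _root_.HasDerivAt.mink {f g : ℝ → Mink n} {f' g' : Mink n} {s : ℝ}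
    (hf : HasDerivAt f f' s) (hg : HasDerivAt g g' s) :
    HasDerivAt (fun s => HypFlow.mink (f s) (g s))
      (HypFlow.mink f' (g s) + HypFlow.mink (f s) g') s := by
  have h := ((minkL n).hasFDerivAt_of_bilinear hf.hasFDerivAt hg.hasFDerivAt).hasDerivAt
  simpa [minkL_apply, add_comm] using h

lemma continuous_mink : Continuous fun z : Mink n × Mink n => mink z.1 z.2 := by
  unfold mink; fun_prop

lemma norm_sq_le_of_orth {u v : Mink n} (hu : mink u u = -1) (h : mink u v = 0) :
    ‖v.2‖ ^ 2 ≤ u.1 ^ 2 * mink v v := by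
  rw [mink_self] at hu ⊢
  have h1 : u.1 * v.1 = inner ℝ u.2 v.2 := by simp only [mink] at h; linarith
  have h2 := real_inner_mul_inner_self_le u.2 v.2
  rw [← h1, real_inner_self_eq_norm_sq, real_inner_self_eq_norm_sq] at h2
  nlinarith

lemma mink_self_nonneg_of_orth {u v : Mink n} (hu : mink u u = -1) (h : mink u v = 0) :
    0 ≤ mink v v := by
  have h1 := norm_sq_le_of_orth hu h
  have h2 : 0 < u.1 ^ 2 := by rw [mink_self] at hu; nlinarith [sq_nonneg ‖u.2‖]
  have h3 : 0 ≤ u.1 ^ 2 * mink v v := (sq_nonneg _).trans h1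
  exact nonneg_of_mul_nonneg_right h3 h2

lemma eq_zero_of_orth {u v : Mink n} (hu : mink u u = -1) (h : mink u v = 0)
    (hv : mink v v = 0) : v = 0 := by
  have h1 := norm_sq_le_of_orth hu h
  rw [hv, mul_zero] at h1
  have h2 : ‖v.2‖ = 0 := by nlinarith [sq_nonneg ‖v.2‖]
  rw [mink_self, h2] at hv
  exact Prod.ext (by simpa using hv) (norm_eq_zero.1 h2)

/-- Cauchy-Schwarz on the orthogonal complement of a timelike vector. -/
lemma mink_sq_le_of_orth {u v w : Mink n} (hu : mink u u = -1) (hv : mink u v = 0)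
    (hw : mink u w = 0) : mink v w ^ 2 ≤ mink v v * mink w w := by
  have h : ∀ t : ℝ, 0 ≤ mink w w * (t * t) + (2 * mink v w) * t + mink v v := by
    intro t
    have := mink_self_nonneg_of_orth (v := v + t • w) hu
      (by rw [mink_add_right, mink_smul_right, hv, hw]; ring)
    simp only [mink_add_left, mink_add_right, mink_smul_left, mink_smul_right,
      mink_comm w v] at this
    linarith
  have := discrim_le_zero h
  unfold discrim at this
  linarith

/-- A null frame: two null vectors with product `-2`. -/
structure IsNullPair (p q : Mink n) : Prop where
  left : mink p p = 0
  right : mink q q = 0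
  pairing : mink p q = -2

lemma IsNullPair.symm {p q : Mink n} (h : IsNullPair p q) : IsNullPair q p :=
  ⟨h.right, h.left, by rw [mink_comm, h.pairing]⟩

/-- Cauchy-Schwarz for a vector orthogonal to a null frame and an arbitrary vector. -/
lemma IsNullPair.mink_sq_le {p q d : Mink n} (h : IsNullPair p q) (hp : mink d p = 0)
    (hq : mink d q = 0) (a : Mink n) :
    mink d a ^ 2 ≤ mink d d * (mink a a + mink a p * mink a q) := by
  have hpq := h.pairing
  have hqp := h.symm.pairing
  have hpp := h.left
  have hqq := h.right
  have e := mink_sq_le_of_orth (u := (1 / 2 : ℝ) • (p + q)) (v := d)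
    (w := a + (mink a q / 2) • p + (mink a p / 2) • q)
    (by simp only [mink_add_left, mink_add_right, mink_smul_left, mink_smul_right, hpq, hqp, hpp,
          hqq]; norm_num)
    (by simp only [mink_add_left, mink_smul_left, mink_comm p d, mink_comm q d, hp, hq]; norm_num)
    (by simp only [mink_add_left, mink_add_right, mink_smul_left, mink_smul_right, hpq, hqp, hpp,
          hqq, mink_comm p a, mink_comm q a]; ring)
  simp only [mink_add_left, mink_add_right, mink_smul_left, mink_smul_right, hpq, hqp, hpp,
    hqq, mink_comm p a, mink_comm q a, hp, hq] at e
  calc _ = (mink d a + mink a q / 2 * 0 + mink a p / 2 * 0) ^ 2 := by ring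
    _ ≤ _ := e
    _ = _ := by ring

lemma IsNullPair.mink_self_nonneg {p q d : Mink n} (h : IsNullPair p q) (hp : mink d p = 0)
    (hq : mink d q = 0) : 0 ≤ mink d d := by
  refine mink_self_nonneg_of_orth (u := (1 / 2 : ℝ) • (p + q)) ?_ ?_
  · simp only [mink_add_left, mink_add_right, mink_smul_left, mink_smul_right, h.pairing,
      h.symm.pairing, h.left, h.right]; norm_num
  · simp only [mink_add_left, mink_smul_left, mink_comm p d, mink_comm q d, hp, hq]; norm_num

lemma norm_snd_eq_of_null {p : Mink n} (hp : mink p p = 0) (h0 : 0 < p.1) : ‖p.2‖ = p.1 := by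
  rw [mink_self] at hp
  nlinarith [norm_nonneg p.2, sq_nonneg (‖p.2‖ - p.1)]

lemma mink_nonpos_of_null {p q : Mink n} (hp : mink p p = 0) (hp0 : 0 < p.1)
    (hq : mink q q = 0) (hq0 : 0 < q.1) : mink p q ≤ 0 := by
  have h := real_inner_le_norm p.2 q.2
  rw [norm_snd_eq_of_null hp hp0, norm_snd_eq_of_null hq hq0] at h
  simp only [mink]; linarith

lemma eq_smul_of_null {p q : Mink n} (hp : mink p p = 0) (hp0 : 0 < p.1)
    (hq : mink q q = 0) (hq0 : 0 < q.1) (h : mink p q = 0) : q = (q.1 / p.1) • p := by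
  have h1 := norm_snd_eq_of_null hp hp0
  have h2 := norm_snd_eq_of_null hq hq0
  have h3 : ‖q.2 - (q.1 / p.1) • p.2‖ ^ 2 = 0 := by
    rw [norm_sub_sq_real, norm_smul, real_inner_smul_right, mul_pow, Real.norm_eq_abs, sq_abs,
      h1, h2, real_inner_comm]
    have : inner ℝ p.2 q.2 = p.1 * q.1 := by simp only [mink] at h; linarith
    rw [this]; field_simp; ring
  have h4 := sub_eq_zero.1 (norm_eq_zero.1 (pow_eq_zero_iff two_ne_zero |>.1 h3))
  refine Prod.ext ?_ h4
  simp; field_simp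

/-- A null vector that has negative product with a vector of the hyperboloid is future directed. -/
lemma fst_pos_of_null {p u : Mink n} (hp : mink p p = 0) (hu : u ∈ hyp n) (h : mink p u < 0) :
    0 < p.1 := by
  obtain ⟨hu1, hu0⟩ := hu
  rw [mink_self] at hp hu1
  by_contra! hneg
  have h1 := abs_real_inner_le_norm p.2 u.2
  have h2 : ‖p.2‖ = -p.1 := by
    nlinarith [norm_nonneg p.2, sq_nonneg (‖p.2‖ + p.1)]
  have h3 : ‖u.2‖ ≤ u.1 := by nlinarith [norm_nonneg u.2]
  simp only [mink] at h
  have h4 := neg_abs_le (inner ℝ p.2 u.2)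
  rw [h2] at h1
  nlinarith

end MinkowskiAlgebra

/-- A differential inequality: if `τ` grows slowly in terms of `√τ`, and so does `lam`, both stay
close to their initial values `0` and `1`. -/
lemma abs_sub_one_le_of_deriv {lam tau lam' tau' : ℝ → ℝ} {ε s : ℝ} (hε : 0 ≤ ε) (hs : 0 ≤ s)
    (hl : ∀ r ∈ Icc 0 s, HasDerivAt lam (lam' r) r)
    (ht : ∀ r ∈ Icc 0 s, HasDerivAt tau (tau' r) r)
    (ht0 : ∀ r ∈ Icc 0 s, 0 ≤ tau r) (hl1 : lam 0 = 1) (ht1 : tau 0 = 0)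
    (hl' : ∀ r ∈ Icc 0 s, lam' r ^ 2 ≤ 4 * tau r)
    (ht' : ∀ r ∈ Icc 0 s, tau' r ^ 2 ≤ 16 * ε ^ 2 * tau r) :
    |lam s - 1| ≤ 4 * ε * s ^ 2 := by
  have key : ∀ r ∈ Icc 0 s, Real.sqrt (tau r) ≤ 2 * ε * r := by
    intro r hr
    refine le_of_forall_pos_le_add fun δ hδ => ?_
    have hδ2 : 0 < δ ^ 2 := by positivity
    have hd : ∀ x ∈ Icc 0 r, HasDerivWithinAt (fun x => Real.sqrt (tau x + δ ^ 2))
        (tau' x / (2 * Real.sqrt (tau x + δ ^ 2))) (Icc 0 r) x := by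
      intro x hx
      have hx' : x ∈ Icc 0 s := ⟨hx.1, hx.2.trans hr.2⟩
      have h0 := ht0 x hx'
      exact (((ht x hx').add_const _).sqrt (add_pos_of_nonneg_of_pos h0 hδ2).ne').hasDerivWithinAt
    have hb : ∀ x ∈ Ico 0 r, ‖tau' x / (2 * Real.sqrt (tau x + δ ^ 2))‖ ≤ 2 * ε := by
      intro x hx
      have hx' : x ∈ Icc 0 s := ⟨hx.1, hx.2.le.trans hr.2⟩
      have h0 := ht0 x hx'
      have hpos : 0 < Real.sqrt (tau x + δ ^ 2) := Real.sqrt_pos.2 (add_pos_of_nonneg_of_pos h0 hδ2)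
      rw [norm_div, Real.norm_eq_abs, Real.norm_eq_abs, abs_of_pos (mul_pos two_pos hpos),
        div_le_iff₀ (by positivity)]
      refine abs_le_of_sq_le_sq ?_ (by positivity)
      have h2 : Real.sqrt (tau x + δ ^ 2) ^ 2 = tau x + δ ^ 2 := Real.sq_sqrt (by positivity)
      calc tau' x ^ 2 ≤ 16 * ε ^ 2 * tau x := ht' x hx'
        _ ≤ 16 * ε ^ 2 * (tau x + δ ^ 2) := by gcongr; linarith
        _ = _ := by rw [mul_pow, mul_pow (2 : ℝ) (√_), h2]; ring
    have h := norm_image_sub_le_of_norm_deriv_le_segment' hd hb r ⟨hr.1, le_rfl⟩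
    rw [ht1, zero_add, Real.sqrt_sq hδ.le, sub_zero] at h
    have h3 := (le_abs_self _).trans h
    have h4 : Real.sqrt (tau r) ≤ Real.sqrt (tau r + δ ^ 2) := Real.sqrt_le_sqrt (by linarith)
    linarith
  have h := norm_image_sub_le_of_norm_deriv_le_segment' (f := lam) (f' := lam') (C := 4 * ε * s)
    (a := 0) (b := s) (fun x hx => (hl x hx).hasDerivWithinAt) ?_ s ⟨hs, le_rfl⟩
  · rw [hl1, sub_zero, Real.norm_eq_abs] at h
    linarith
  · intro x hx
    have hx' : x ∈ Icc 0 s := ⟨hx.1, hx.2.le⟩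
    rw [Real.norm_eq_abs]
    refine abs_le_of_sq_le_sq ?_ (by positivity)
    have h1 := key x hx'
    have h2 : tau x ≤ (2 * ε * x) ^ 2 := by
      rw [← Real.sq_sqrt (ht0 x hx')]; gcongr
    calc lam' x ^ 2 ≤ 4 * tau x := hl' x hx'
      _ ≤ 4 * (2 * ε * x) ^ 2 := by gcongr
      _ ≤ 4 * (2 * ε * s) ^ 2 := by
        have := hx.1
        gcongr; exact hx.2.le
      _ = _ := by ring

/-- The evolution, along a curve, of the products of a moving null frame `(P, X)` with a fixed null
vector `a`. -/
lemma abs_mink_add_one_le {P X P' X' : ℝ → Mink n} {a : Mink n} {ε s : ℝ} (hε : 0 ≤ ε)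
    (hs : 0 ≤ s) (hPd : ∀ r ∈ Icc 0 s, HasDerivAt P (P' r) r)
    (hXd : ∀ r ∈ Icc 0 s, HasDerivAt X (X' r) r)
    (hPX : ∀ r ∈ Icc 0 s, IsNullPair (P r) (X r))
    (hX0 : ∀ r ∈ Icc 0 s, 0 < (X r).1)
    (ha : mink a a = 0) (ha0 : 0 < a.1)
    (h1 : ∀ r ∈ Icc 0 s, mink (P' r) (P r) = 0) (h2 : ∀ r ∈ Icc 0 s, mink (P' r) (X r) = 0)
    (h3 : ∀ r ∈ Icc 0 s, mink (X' r) (P r) = 0) (h4 : ∀ r ∈ Icc 0 s, mink (X' r) (X r) = 0)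
    (h5 : ∀ r ∈ Icc 0 s, mink (X' r) (X' r) ≤ ε ^ 2 * mink (P' r) (P' r))
    (h6 : ∀ r ∈ Icc 0 s, mink (P' r) (P' r) ≤ 4)
    (h7 : ∀ r ∈ Icc 0 s, -4 ≤ mink a (P r))
    (h8 : ∀ r ∈ Icc 0 s, mink a (P r) ≤ 0)
    (hP0 : mink (P 0) a = -2) (hX1 : mink (X 0) a = 0) :
    |-mink (P s) a / 2 - 1| ≤ 4 * ε * s ^ 2 := by
  have hconst : ∀ r, HasDerivAt (fun _ : ℝ => a) 0 r := fun r => hasDerivAt_const r a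
  have hτ : ∀ r ∈ Icc 0 s, 0 ≤ -mink (X r) a := fun r hr =>
    neg_nonneg.2 (mink_nonpos_of_null (hPX r hr).right (hX0 r hr) ha ha0)
  refine abs_sub_one_le_of_deriv (lam := fun r => -mink (P r) a / 2)
    (tau := fun r => -mink (X r) a) (lam' := fun r => -mink (P' r) a / 2)
    (tau' := fun r => -mink (X' r) a) hε hs ?_ ?_ hτ ?_ ?_ ?_ ?_
  · intro r hr
    have := ((hPd r hr).mink (hconst r)).fun_neg.div_const 2
    simpa [mink_zero_right] using this
  · intro r hr
    have := ((hXd r hr).mink (hconst r)).fun_neg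
    simpa [mink_zero_right] using this
  · simp [hP0]
  · simp [hX1]
  · intro r hr
    have := (hPX r hr).mink_sq_le (h1 r hr) (h2 r hr) a
    have hb := h6 r hr
    have hn := (hPX r hr).mink_self_nonneg (h1 r hr) (h2 r hr)
    have ht := hτ r hr
    rw [ha, zero_add, mink_comm a (X r)] at this
    have h7' := h7 r hr
    have h8' := h8 r hr
    have e1 : mink a (P r) * mink (X r) a ≤ 4 * -mink (X r) a := by nlinarith
    have e0 : 0 ≤ mink a (P r) * mink (X r) a := by nlinarith
    have : mink (P' r) a ^ 2 ≤ 4 * (4 * -mink (X r) a) :=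
      this.trans (mul_le_mul hb e1 e0 (by norm_num))
    nlinarith
  · intro r hr
    have := (hPX r hr).mink_sq_le (h3 r hr) (h4 r hr) a
    have hb := h6 r hr
    have h5' := h5 r hr
    have ht := hτ r hr
    rw [ha, zero_add, mink_comm a (X r)] at this
    have h7' := h7 r hr
    have h8' := h8 r hr
    have e1 : mink a (P r) * mink (X r) a ≤ 4 * -mink (X r) a := by nlinarith
    have e0 : 0 ≤ mink a (P r) * mink (X r) a := by nlinarith
    have e2 : mink (X' r) (X' r) ≤ ε ^ 2 * 4 := h5'.trans (by gcongr)
    have : mink (X' r) a ^ 2 ≤ (ε ^ 2 * 4) * (4 * -mink (X r) a) :=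
      this.trans (mul_le_mul e2 e1 e0 (by positivity))
    nlinarith

section Pair

variable {n : ℕ} {M : Type*} [TopologicalSpace M] [ChartedSpace (EuclideanSpace ℝ (Fin n)) M]

lemma mink_dMink_add {φ ψ : M → Mink n} {p : M}
    (hφ : MDifferentiableAt (𝓡 n) 𝓘(ℝ, Mink n) φ p)
    (hψ : MDifferentiableAt (𝓡 n) 𝓘(ℝ, Mink n) ψ p) {c : ℝ}
    (h : ∀ q, mink (φ q) (ψ q) = c) (v : TangentSpace (𝓡 n) p) :
    mink (dMink φ p v) (ψ p) + mink (φ p) (dMink ψ p v) = 0 := by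
  have aux : ∀ A B : EuclideanSpace ℝ (Fin n) →L[ℝ] Mink n,
      HasFDerivWithinAt (writtenInExtChartAt (𝓡 n) 𝓘(ℝ, Mink n) p φ) A (range (𝓡 n))
        (extChartAt (𝓡 n) p p) →
      HasFDerivWithinAt (writtenInExtChartAt (𝓡 n) 𝓘(ℝ, Mink n) p ψ) B (range (𝓡 n))
        (extChartAt (𝓡 n) p p) →
      ∀ v, mink (A v) (ψ p) + mink (φ p) (B v) = 0 := by
    intro A B h1 h2 v
    have h3 := (minkL n).hasFDerivWithinAt_of_bilinear h1 h2
    have h4 : HasFDerivWithinAt (fun y => minkL n (writtenInExtChartAt (𝓡 n) 𝓘(ℝ, Mink n) p φ y)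
        (writtenInExtChartAt (𝓡 n) 𝓘(ℝ, Mink n) p ψ y))
        (0 : EuclideanSpace ℝ (Fin n) →L[ℝ] ℝ) (range (𝓡 n)) (extChartAt (𝓡 n) p p) := by
      have : (fun y => minkL n (writtenInExtChartAt (𝓡 n) 𝓘(ℝ, Mink n) p φ y)
          (writtenInExtChartAt (𝓡 n) 𝓘(ℝ, Mink n) p ψ y)) = fun _ => c := by
        funext y
        simp only [writtenInExtChartAt, extChartAt_model_space_eq_id, PartialEquiv.refl_coe,
          Function.comp_apply, minkL_apply, id]
        exact h _
      rw [this]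
      exact hasFDerivWithinAt_const _ _ _
    have hu : UniqueDiffWithinAt ℝ (range (𝓡 n)) (extChartAt (𝓡 n) p p) :=
      (𝓡 n).uniqueDiffOn _ (mem_range_self _)
    have h5 := DFunLike.congr_fun (hu.eq h3 h4) v
    simp only [writtenInExtChartAt, extChartAt_model_space_eq_id, PartialEquiv.refl_coe,
      Function.comp_apply, extChartAt_to_inv, id, add_apply,
      ContinuousLinearMap.precompR_apply, ContinuousLinearMap.precompL_apply, minkL_apply,
      zero_apply] at h5
    rw [add_comm]
    exact h5
  exact aux _ _ hφ.hasMFDerivAt.2 hψ.hasMFDerivAt.2 v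

/-- A pair of future directed null maps with constant product `-2`, the first one immersed, such
that the differential of the second one is bounded by `ε` times the differential of the first one.
The map `(Ψ + Ξ) / 2` is then a hypersurface with light cone Gauss maps `Ψ` and `Ξ`. -/
structure IsNullMapPair (ε : ℝ) (Ψ Ξ : M → Mink n) : Prop where
  smooth_left : ContMDiff (𝓡 n) 𝓘(ℝ, Mink n) ∞ Ψ
  smooth_right : ContMDiff (𝓡 n) 𝓘(ℝ, Mink n) ∞ Ξ
  nullPair : ∀ p, IsNullPair (Ψ p) (Ξ p)
  left_pos : ∀ p, 0 < (Ψ p).1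
  right_pos : ∀ p, 0 < (Ξ p).1
  orth : ∀ p v, mink (dMink Ψ p v) (Ξ p) = 0
  immersion : ∀ p, Function.Injective (dMink Ψ p)
  bound : ∀ p v, mink (dMink Ξ p v) (dMink Ξ p v) ≤ ε ^ 2 * mink (dMink Ψ p v) (dMink Ψ p v)
  eq_of_mink_eq_zero : ∀ p q, mink (Ψ p) (Ψ q) = 0 → p = q

namespace IsNullMapPair

variable {ε : ℝ} {Ψ Ξ : M → Mink n}

lemma mdiff_left (h : IsNullMapPair ε Ψ Ξ) (p : M) : MDifferentiableAt (𝓡 n) 𝓘(ℝ, Mink n) Ψ p :=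
  h.smooth_left.mdifferentiable (by simp) p

lemma mdiff_right (h : IsNullMapPair ε Ψ Ξ) (p : M) : MDifferentiableAt (𝓡 n) 𝓘(ℝ, Mink n) Ξ p :=
  h.smooth_right.mdifferentiable (by simp) p

lemma dleft_left (h : IsNullMapPair ε Ψ Ξ) (p : M) (v) : mink (dMink Ψ p v) (Ψ p) = 0 := by
  have := mink_dMink_add (h.mdiff_left p) (h.mdiff_left p) (fun q => (h.nullPair q).left) v
  rw [mink_comm (Ψ p)] at this; linarith

lemma dright_right (h : IsNullMapPair ε Ψ Ξ) (p : M) (v) : mink (dMink Ξ p v) (Ξ p) = 0 := by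
  have := mink_dMink_add (h.mdiff_right p) (h.mdiff_right p) (fun q => (h.nullPair q).right) v
  rw [mink_comm (Ξ p)] at this; linarith

lemma dright_left (h : IsNullMapPair ε Ψ Ξ) (p : M) (v) : mink (dMink Ξ p v) (Ψ p) = 0 := by
  have := mink_dMink_add (h.mdiff_left p) (h.mdiff_right p) (fun q => (h.nullPair q).pairing) v
  rw [mink_comm (Ψ p), h.orth] at this; linarith

lemma mink_half_half (h : IsNullMapPair ε Ψ Ξ) (p : M) :
    mink ((1 / 2 : ℝ) • (Ψ p + Ξ p)) ((1 / 2 : ℝ) • (Ψ p + Ξ p)) = -1 := by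
  have := h.nullPair p
  simp only [mink_add_left, mink_add_right, mink_smul_left, mink_smul_right, this.pairing,
    this.symm.pairing, this.left, this.right]; norm_num

lemma spacelike (h : IsNullMapPair ε Ψ Ξ) (p : M) (v) (hv : v ≠ 0) : 0 < mink (dMink Ψ p v) (dMink Ψ p v) := by
  have ho : mink ((1 / 2 : ℝ) • (Ψ p + Ξ p)) (dMink Ψ p v) = 0 := by
    rw [mink_comm, mink_smul_right, mink_add_right, h.dleft_left, h.orth]; norm_num
  refine lt_of_le_of_ne (mink_self_nonneg_of_orth (h.mink_half_half p) ho) fun h0 => hv ?_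
  have := eq_zero_of_orth (h.mink_half_half p) ho h0.symm
  exact h.immersion p (by rw [this, map_zero])

end IsNullMapPair
end Pair

section LocalSection

variable {n : ℕ} {M : Type*} [TopologicalSpace M] [ChartedSpace (EuclideanSpace ℝ (Fin n)) M]
  {ε : ℝ} {Ψ Ξ : M → Mink n}

lemma finrank_mink : Module.finrank ℝ (Mink n) = n + 2 := by
  simp [Mink, Module.finrank_prod]; ring

lemma linear_surjective_of_injective {V : Type*} [AddCommGroup V] [Module ℝ V]
    [FiniteDimensional ℝ V] (hV : Module.finrank ℝ V = n) {L : V × ℝ × ℝ →ₗ[ℝ] Mink n}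
    (hL : Function.Injective L) : Function.Bijective L := by
  refine ⟨hL, (LinearMap.injective_iff_surjective_of_finrank_eq_finrank ?_).1 hL⟩
  rw [finrank_mink, Module.finrank_prod, Module.finrank_prod, hV]; simp

/-- Near a point, an immersed light cone map has a local section defined on the light cone. -/
lemma IsNullMapPair.exists_local_section [IsManifold (𝓡 n) ∞ M] (h : IsNullMapPair ε Ψ Ξ)
    (q : M) : ∃ k : Mink n → M, k (Ψ q) = q ∧
      (∀ᶠ Y in 𝓝 (Ψ q), ContMDiffAt 𝓘(ℝ, Mink n) (𝓡 n) 1 k Y) ∧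
      ∀ᶠ Y in 𝓝 (Ψ q), mink Y Y = 0 → ∃ r : ℝ, 0 < r ∧ Y = r • Ψ (k Y) := by
  set e := extChartAt (𝓡 n) q with he
  set g : EuclideanSpace ℝ (Fin n) → Mink n := fun z => Ψ (e.symm z) with hg
  have hgd : ContDiffAt ℝ 1 g (e q) := by
    have h1 := (contMDiffAt_iff.1 (h.smooth_left q)).2
    rw [ModelWithCorners.range_eq_univ, contDiffWithinAt_univ] at h1
    exact h1.of_le (by simp)
  obtain ⟨A, hAΨ, hAΞ, hAi, hAd⟩ : ∃ A : EuclideanSpace ℝ (Fin n) →L[ℝ] Mink n,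
      (∀ v, mink (A v) (Ψ q) = 0) ∧ (∀ v, mink (A v) (Ξ q) = 0) ∧ Function.Injective A ∧
      HasFDerivAt g A (e q) := by
    refine ⟨dMink Ψ q, h.dleft_left q, h.orth q, h.immersion q, ?_⟩
    have h1 := (h.mdiff_left q).hasMFDerivAt.2
    rw [ModelWithCorners.range_eq_univ] at h1
    exact hasFDerivWithinAt_univ.1 h1
  have hgq : g (e q) = Ψ q := by simp [hg, he]
  set f : EuclideanSpace ℝ (Fin n) × ℝ × ℝ → Mink n :=
    fun z => z.2.1 • g z.1 + z.2.2 • Ξ q with hf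
  set z₀ : EuclideanSpace ℝ (Fin n) × ℝ × ℝ := (e q, 1, 0) with hz₀
  have hfd : ContDiffAt ℝ 1 f z₀ := by
    have h1 : ContDiffAt ℝ 1 (fun z : EuclideanSpace ℝ (Fin n) × ℝ × ℝ => g z.1) z₀ :=
      ContDiffAt.comp (g := g) z₀ hgd contDiffAt_fst
    have h2 : ContDiff ℝ 1 (fun z : EuclideanSpace ℝ (Fin n) × ℝ × ℝ => z.2.1) := by fun_prop
    have h3 : ContDiff ℝ 1 (fun z : EuclideanSpace ℝ (Fin n) × ℝ × ℝ => z.2.2 • Ξ q) := by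
      fun_prop
    exact (h2.contDiffAt.smul h1).add h3.contDiffAt
  set L : EuclideanSpace ℝ (Fin n) × ℝ × ℝ →L[ℝ] Mink n :=
    A.comp (ContinuousLinearMap.fst ℝ _ _) +
      ((ContinuousLinearMap.fst ℝ ℝ ℝ).comp (ContinuousLinearMap.snd ℝ _ _)).smulRight (Ψ q) +
      ((ContinuousLinearMap.snd ℝ ℝ ℝ).comp (ContinuousLinearMap.snd ℝ _ _)).smulRight (Ξ q)
    with hL
  have hLa : ∀ v r b, L (v, r, b) = A v + r • Ψ q + b • Ξ q := fun v r b => by simp [hL]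
  have hfL : HasFDerivAt f L z₀ := by
    have h1 : HasFDerivAt (fun z : EuclideanSpace ℝ (Fin n) × ℝ × ℝ => g z.1)
        (A.comp (ContinuousLinearMap.fst ℝ _ _)) z₀ :=
      HasFDerivAt.comp (g := g) z₀ hAd hasFDerivAt_fst
    have h2 : HasFDerivAt (fun z : EuclideanSpace ℝ (Fin n) × ℝ × ℝ => z.2.1)
        ((ContinuousLinearMap.fst ℝ ℝ ℝ).comp (ContinuousLinearMap.snd ℝ _ _)) z₀ :=
      HasFDerivAt.fst hasFDerivAt_snd
    have h3 : HasFDerivAt (fun z : EuclideanSpace ℝ (Fin n) × ℝ × ℝ => z.2.2)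
        ((ContinuousLinearMap.snd ℝ ℝ ℝ).comp (ContinuousLinearMap.snd ℝ _ _)) z₀ :=
      HasFDerivAt.snd hasFDerivAt_snd
    refine ((h2.smul h1).add (h3.smul_const (Ξ q))).congr_fderiv
      (ContinuousLinearMap.ext fun z => ?_)
    simp [hL, hz₀, hgq]
  have hnp := h.nullPair q
  have hinj : Function.Injective L := by
    rw [injective_iff_map_eq_zero]
    rintro ⟨v, r, b⟩ hv
    rw [hLa] at hv
    have h1 := congrArg (fun y => mink y (Ψ q)) hv
    have h2 := congrArg (fun y => mink y (Ξ q)) hv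
    simp only [mink_add_left, mink_smul_left, hnp.left, hnp.right, hnp.pairing, hnp.symm.pairing,
      hAΨ, hAΞ, mink_zero_left] at h1 h2
    have hb : b = 0 := by linarith
    have hr : r = 0 := by linarith
    subst hb hr
    simp only [zero_smul, add_zero] at hv
    have hv0 : v = 0 := hAi (by rw [hv, map_zero])
    rw [hv0]; rfl
  have hbij := linear_surjective_of_injective (n := n) (V := EuclideanSpace ℝ (Fin n)) (by simp)
    (L := (L : EuclideanSpace ℝ (Fin n) × ℝ × ℝ →ₗ[ℝ] Mink n)) hinj
  set L' := (LinearEquiv.ofBijective _ hbij).toContinuousLinearEquiv with hL'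
  have hfL' : HasFDerivAt f (L' : EuclideanSpace ℝ (Fin n) × ℝ × ℝ →L[ℝ] Mink n) z₀ := by
    convert hfL using 1
    exact ContinuousLinearMap.ext fun z => rfl
  have hfz : f z₀ = Ψ q := by simp [hf, hz₀, hgq]
  set loc := hfd.localInverse hfL' one_ne_zero with hloc
  have hlz : loc (Ψ q) = z₀ := by
    rw [← hfz]; exact hfd.localInverse_apply_image hfL' one_ne_zero
  have hlc : ContDiffAt ℝ 1 loc (Ψ q) := by
    rw [← hfz]; exact hfd.to_localInverse hfL' one_ne_zero
  have hri : ∀ᶠ Y in 𝓝 (Ψ q), f (loc Y) = Y := by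
    rw [← hfz]
    exact (hfd.hasStrictFDerivAt' hfL' one_ne_zero).eventually_right_inverse
  have htgt : ∀ᶠ Y in 𝓝 (Ψ q), (loc Y).1 ∈ e.target := by
    refine (continuous_fst.continuousAt.comp hlc.continuousAt).eventually_mem ?_
    simp only [Function.comp_apply, hlz, hz₀]
    exact extChartAt_target_mem_nhds q
  have hpos : ∀ᶠ Y in 𝓝 (Ψ q), 0 < (loc Y).2.1 := by
    have : ContinuousAt (fun Y => (loc Y).2.1) (Ψ q) :=
      ((continuous_fst.comp continuous_snd).continuousAt).comp hlc.continuousAt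
    refine this.eventually_const_lt ?_
    simp [hlz, hz₀]
  have hne : ∀ᶠ Y in 𝓝 (Ψ q), mink (g (loc Y).1) (Ξ q) < 0 := by
    have h0 : ContinuousAt (fun Y => g (loc Y).1) (Ψ q) := by
      refine ContinuousAt.comp (g := g) ?_ (continuous_fst.continuousAt.comp hlc.continuousAt)
      simp only [hlz, hz₀]
      exact hgd.continuousAt
    have : ContinuousAt (fun Y => mink (g (loc Y).1) (Ξ q)) (Ψ q) :=
      continuous_mink.continuousAt.comp (h0.prodMk continuousAt_const)
    refine this.eventually_lt_const ?_
    simp [hlz, hz₀, hgq, hnp.pairing]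
  refine ⟨fun Y => e.symm (loc Y).1, by simp [hlz, hz₀, he], ?_, ?_⟩
  · filter_upwards [htgt, hlc.eventually (by simp)] with Y h1 h2
    have h3 : ContMDiffAt 𝓘(ℝ, EuclideanSpace ℝ (Fin n)) (𝓡 n) 1 e.symm (loc Y).1 :=
      ((contMDiffOn_extChartAt_symm (I := 𝓡 n) (n := ∞) q).contMDiffAt
        ((isOpen_extChartAt_target q).mem_nhds h1)).of_le (by simp)
    have h4 : ContDiffAt ℝ 1 (fun Y => (loc Y).1) Y := contDiffAt_fst.comp Y h2
    exact h3.comp Y h4.contMDiffAt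
  · filter_upwards [hri, hpos, hne] with Y h1 h2 h3 hY
    refine ⟨(loc Y).2.1, h2, ?_⟩
    have h4 : Y = (loc Y).2.1 • g (loc Y).1 + (loc Y).2.2 • Ξ q := h1.symm
    have h5 : mink (g (loc Y).1) (g (loc Y).1) = 0 := (h.nullPair _).left
    have h6 : (loc Y).2.2 = 0 := by
      rw [h4] at hY
      simp only [mink_add_left, mink_add_right, mink_smul_left, mink_smul_right, h5, hnp.right,
        mink_comm (Ξ q)] at hY
      have : (loc Y).2.1 * mink (g (loc Y).1) (Ξ q) * (loc Y).2.2 = 0 := by linarith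
      exact (mul_eq_zero.1 this).resolve_left (mul_ne_zero h2.ne' h3.ne)
    rw [h6, zero_smul, add_zero] at h4
    exact h4

end LocalSection

section Lift

variable {n : ℕ} {M : Type*} [TopologicalSpace M] [ChartedSpace (EuclideanSpace ℝ (Fin n)) M]

/-- In a complete metric, a curve of bounded speed on a bounded half-open interval accumulates at
some point as the parameter tends to the open end. -/
lemma IsCompleteMetric.exists_tendsto {N : ∀ p : M, TangentSpace (𝓡 n) p → ℝ}
    (hN : IsCompleteMetric N) (hsmul : ∀ p (c : ℝ) v, N p (c • v) = |c| * N p v)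
    {γ : ℝ → M} {b K : ℝ} (hb : 0 < b)
    (hγ : ∀ r ∈ Ico 0 b, ContMDiffAt 𝓘(ℝ, ℝ) (𝓡 n) 1 γ r)
    (hK : ∀ r ∈ Ico 0 b, N (γ r) (mfderiv 𝓘(ℝ, ℝ) (𝓡 n) γ r (1 : ℝ)) ≤ K) :
    ∃ (u : ℕ → ℝ) (q : M), (∀ k, u k ∈ Ico 0 b) ∧ Tendsto u atTop (𝓝 b) ∧
      Tendsto (fun k => γ (u k)) atTop (𝓝 q) := by
  let _ : ∀ p : M, ENorm (TangentSpace (𝓡 n) p) := fun p => ⟨fun v => ENNReal.ofReal (N p v)⟩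
  have : ∀ p : M, ENormSMulClass ℝ (TangentSpace (𝓡 n) p) := fun p =>
    ⟨fun c v => by
      change ENNReal.ofReal (N p (c • v)) = ‖c‖ₑ * ENNReal.ofReal (N p v)
      rw [hsmul, ENNReal.ofReal_mul (abs_nonneg c), Real.enorm_eq_ofReal_abs]⟩
  have key : ∀ r ∈ Ico 0 b, ∀ s ∈ Ico 0 b, r ≤ s →
      Manifold.riemannianEDist (𝓡 n) (γ r) (γ s) ≤ ENNReal.ofReal K * ENNReal.ofReal (s - r) := by
    intro r hr s hs hrs
    have hsub : Icc r s ⊆ Ico 0 b := fun t ht => ⟨hr.1.trans ht.1, ht.2.trans_lt hs.2⟩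
    refine (Manifold.riemannianEDist_le_pathELength (a := r) (b := s) (γ := γ)
      (fun t ht => (hγ t (hsub ht)).contMDiffWithinAt) rfl rfl hrs).trans ?_
    rw [Manifold.pathELength_eq_lintegral_mfderiv_Icc]
    refine (MeasureTheory.setLIntegral_mono (g := fun _ => ENNReal.ofReal K) measurable_const
      fun t ht => ENNReal.ofReal_le_ofReal (hK t (hsub ht))).trans_eq ?_
    rw [MeasureTheory.setLIntegral_const, Real.volume_Icc]
  set u : ℕ → ℝ := fun k => b - b / (k + 1) with hu
  have hub : ∀ k, u k ∈ Ico 0 b := by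
    intro k
    have h1 : b / (k + 1) ≤ b := div_le_self hb.le (by linarith [(Nat.cast_nonneg k : (0 : ℝ) ≤ k)])
    have h2 : 0 < b / ((k : ℝ) + 1) := by positivity
    exact ⟨by simp only [hu]; linarith, by simp only [hu]; linarith⟩
  have hut : Tendsto u atTop (𝓝 b) := by
    have h1 : Tendsto (fun k : ℕ => b * (1 / ((k : ℝ) + 1))) atTop (𝓝 (b * 0)) :=
      tendsto_one_div_add_atTop_nhds_zero_nat.const_mul b
    have h2 := h1.const_sub b
    simpa [hu, div_eq_mul_inv] using h2
  obtain ⟨q, hq⟩ := hN (fun k => γ (u k)) (by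
    intro e he
    have hlim : Tendsto (fun x => ENNReal.ofReal K * ENNReal.ofReal (b - x)) (𝓝 b) (𝓝 0) := by
      have h1 : Tendsto (fun x : ℝ => ENNReal.ofReal (b - x)) (𝓝 b) (𝓝 0) := by
        have : Continuous fun x : ℝ => ENNReal.ofReal (b - x) :=
          ENNReal.continuous_ofReal.comp (continuous_const.sub continuous_id)
        simpa using this.tendsto b
      simpa using ENNReal.Tendsto.const_mul h1 (Or.inr ENNReal.ofReal_ne_top)
    obtain ⟨k₀, hk₀⟩ := eventually_atTop.1 ((hlim.comp hut).eventually_lt_const he)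
    refine ⟨k₀, fun k hk l hl => ?_⟩
    have main : ∀ r ∈ Ico 0 b, ∀ s ∈ Ico 0 b, r ≤ s →
        ENNReal.ofReal K * ENNReal.ofReal (b - r) < e →
        Manifold.riemannianEDist (𝓡 n) (γ r) (γ s) < e := by
      intro r hr s hs hrs hlt
      refine ((key r hr s hs hrs).trans ?_).trans_lt hlt
      gcongr
      exact hs.2.le
    rcases le_total (u k) (u l) with hkl | hkl
    · exact main _ (hub k) _ (hub l) hkl (hk₀ k hk)
    · rw [Manifold.riemannianEDist_comm]
      exact main _ (hub l) _ (hub k) hkl (hk₀ l hl))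
  exact ⟨u, q, hub, hut, hq⟩

lemma hasDerivAt_comp_dMink {φ : M → Mink n} {γ : ℝ → M} {r : ℝ}
    (hφ : MDifferentiableAt (𝓡 n) 𝓘(ℝ, Mink n) φ (γ r))
    (hγ : MDifferentiableAt 𝓘(ℝ, ℝ) (𝓡 n) γ r) :
    HasDerivAt (fun s => φ (γ s)) (dMink φ (γ r) (mfderiv 𝓘(ℝ, ℝ) (𝓡 n) γ r (1 : ℝ))) r := by
  have aux : ∀ A : ℝ →L[ℝ] Mink n, HasFDerivAt (fun s => φ (γ s)) A r →
      HasDerivAt (fun s => φ (γ s)) (A 1) r := fun A hA => hA.hasDerivAt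
  exact aux _ (hasMFDerivAt_iff_hasFDerivAt.1 (hφ.hasMFDerivAt.comp r hγ.hasMFDerivAt))

/-- A curve in `M` that projects to a given curve of null directions is differentiable. -/
lemma IsNullMapPair.lift_contMDiffAt [IsManifold (𝓡 n) ∞ M] {ε : ℝ} {Ψ Ξ : M → Mink n}
    (h : IsNullMapPair ε Ψ Ξ) {c : ℝ → Mink n} (hc : ContDiff ℝ 1 c)
    (hc0 : ∀ r, mink (c r) (c r) = 0) {γ : ℝ → M}
    (hγ : ∀ r, (∃ q, ∃ t : ℝ, 0 < t ∧ Ψ q = t • c r) → ∃ t : ℝ, 0 < t ∧ Ψ (γ r) = t • c r)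
    {r₀ : ℝ} (hr₀ : ∃ q, ∃ t : ℝ, 0 < t ∧ Ψ q = t • c r₀) :
    ContMDiffAt 𝓘(ℝ, ℝ) (𝓡 n) 1 γ r₀ ∧ ∀ᶠ r in 𝓝 r₀, ∃ t : ℝ, 0 < t ∧ Ψ (γ r) = t • c r := by
  obtain ⟨t, ht, hq⟩ := hγ r₀ hr₀
  obtain ⟨k, -, hks, hk⟩ := h.exists_local_section (γ r₀)
  have hcs : ContDiff ℝ 1 fun r => t • c r := by fun_prop
  have hev : Tendsto (fun r => t • c r) (𝓝 r₀) (𝓝 (Ψ (γ r₀))) := by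
    rw [hq]; exact hcs.continuous.tendsto r₀
  have hlift : ∀ᶠ r in 𝓝 r₀, ∃ t' : ℝ, 0 < t' ∧ Ψ (k (t • c r)) = t' • c r := by
    filter_upwards [hev.eventually hk] with r hr
    obtain ⟨ρ, hρ, he⟩ := hr (by simp [mink_smul_left, mink_smul_right, hc0])
    refine ⟨ρ⁻¹ * t, by positivity, ?_⟩
    calc Ψ (k (t • c r)) = ρ⁻¹ • (ρ • Ψ (k (t • c r))) := by
          rw [smul_smul, inv_mul_cancel₀ hρ.ne', one_smul]
      _ = (ρ⁻¹ * t) • c r := by rw [← he, mul_smul]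
  have heq : γ =ᶠ[𝓝 r₀] fun r => k (t • c r) := by
    filter_upwards [hlift] with r hr
    obtain ⟨t₁, _, h1⟩ := hr
    obtain ⟨t₂, _, h2⟩ := hγ r ⟨_, t₁, ‹_›, h1⟩
    refine h.eq_of_mink_eq_zero _ _ ?_
    rw [h1, h2]; simp [mink_smul_left, mink_smul_right, hc0]
  constructor
  · refine ContMDiffAt.congr_of_eventuallyEq ?_ heq
    refine ContMDiffAt.comp r₀ (g := k) ?_ hcs.contDiffAt.contMDiffAt
    rw [← hq]
    exact hks.self_of_nhds
  · filter_upwards [hlift] with r hr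
    obtain ⟨t₁, ht₁, h1⟩ := hr
    exact hγ r ⟨_, t₁, ht₁, h1⟩

end Lift

section Lift

variable {n : ℕ} {M : Type*} [TopologicalSpace M] [ChartedSpace (EuclideanSpace ℝ (Fin n)) M]
  {ε : ℝ} {Ψ Ξ : M → Mink n}

/-- Completeness of a metric that is dominated by the one induced by the light cone map `Ψ`. -/
def HasCompleteMetric (Ψ : M → Mink n) : Prop :=
  ∃ (N : ∀ p : M, TangentSpace (𝓡 n) p → ℝ) (C : ℝ), IsCompleteMetric N ∧ 0 ≤ C ∧
    (∀ p (c : ℝ) v, N p (c • v) = |c| * N p v) ∧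
    ∀ p v, N p v ≤ C * Real.sqrt (mink (dMink Ψ p v) (dMink Ψ p v))

lemma IsNullMapPair.half_mem_hyp (h : IsNullMapPair ε Ψ Ξ) (p : M) :
    (1 / 2 : ℝ) • (Ψ p + Ξ p) ∈ hyp n := by
  refine ⟨h.mink_half_half p, ?_⟩
  have h1 := h.left_pos p
  have h2 := h.right_pos p
  simp only [Prod.smul_fst, Prod.fst_add, smul_eq_mul]
  positivity

/-- The curve of null vectors that is a straight line in the horosphere model. -/
def horoLine (p a w : Mink n) (s : ℝ) : Mink n := p + s • w + (s ^ 2 / 4) • a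

lemma hasDerivAt_horoLine (p a w : Mink n) (s : ℝ) :
    HasDerivAt (horoLine p a w) (w + (s / 2) • a) s := by
  have h1 : HasDerivAt (fun s : ℝ => s • w) ((1 : ℝ) • w) s := (hasDerivAt_id s).smul_const w
  have h2 : HasDerivAt (fun s : ℝ => (s ^ 2 / 4) • a) ((s / 2) • a) s := by
    refine HasDerivAt.smul_const ?_ a
    convert (hasDerivAt_pow 2 s).div_const 4 using 1
    simp; ring
  rw [one_smul] at h1
  exact (h1.const_add p).add h2

lemma contDiff_horoLine (p a w : Mink n) : ContDiff ℝ 1 (horoLine p a w) := by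
  unfold horoLine; fun_prop

section

variable {p a w : Mink n}

lemma mink_horoLine_self (hpa : IsNullPair p a) (hw : mink w w = 1) (hwp : mink w p = 0)
    (hwa : mink w a = 0) (s : ℝ) : mink (horoLine p a w s) (horoLine p a w s) = 0 := by
  simp only [horoLine, mink_add_left, mink_add_right, mink_smul_left, mink_smul_right, hw, hwp, hwa,
    mink_comm p w, mink_comm a w, hpa.left, hpa.right, hpa.pairing, hpa.symm.pairing]
  ring

lemma mink_horoLine_right (hpa : IsNullPair p a) (hwa : mink w a = 0) (s : ℝ) :
    mink (horoLine p a w s) a = -2 := by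
  simp only [horoLine, mink_add_left, mink_smul_left, hwa, hpa.right, hpa.pairing]
  ring

lemma mink_horoLine_left (hpa : IsNullPair p a) (hwp : mink w p = 0) (s : ℝ) :
    mink (horoLine p a w s) p = -(s ^ 2 / 2) := by
  simp only [horoLine, mink_add_left, mink_smul_left, hwp, hpa.left, hpa.symm.pairing]
  ring

end

/-- The data of a curve in `M` lying over a straight line of the horosphere model at `x`. -/
structure IsHoroLift (Ψ Ξ : M → Mink n) (x : M) (w : Mink n) (γ : ℝ → M) (r : ℝ) : Prop where
  contMDiffAt : ContMDiffAt 𝓘(ℝ, ℝ) (𝓡 n) 1 γ r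
  eventually : ∀ᶠ s in 𝓝 r, ∃ t : ℝ, 0 < t ∧ Ψ (γ s) = t • horoLine (Ψ x) (Ξ x) w s

/-- The factor between the light cone map and the horosphere model. -/
def horoFactor (Ψ Ξ : M → Mink n) (x y : M) : ℝ := -mink (Ψ y) (Ξ x) / 2

lemma horoFactor_of_eq (h : IsNullMapPair ε Ψ Ξ) {x y : M} {w : Mink n} (hwa : mink w (Ξ x) = 0)
    {t s : ℝ} (hy : Ψ y = t • horoLine (Ψ x) (Ξ x) w s) : horoFactor Ψ Ξ x y = t := by
  rw [horoFactor, hy, mink_smul_left, mink_horoLine_right (h.nullPair x) hwa]; ring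

namespace IsHoroLift

variable {x : M} {w : Mink n} {γ : ℝ → M} {r : ℝ}

lemma mdiff (hγ : IsHoroLift Ψ Ξ x w γ r) : MDifferentiableAt 𝓘(ℝ, ℝ) (𝓡 n) γ r :=
  hγ.contMDiffAt.mdifferentiableAt (by simp)

lemma eq_horoFactor (hγ : IsHoroLift Ψ Ξ x w γ r) (h : IsNullMapPair ε Ψ Ξ)
    (hwa : mink w (Ξ x) = 0) :
    0 < horoFactor Ψ Ξ x (γ r) ∧
      Ψ (γ r) = horoFactor Ψ Ξ x (γ r) • horoLine (Ψ x) (Ξ x) w r := by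
  obtain ⟨t, ht, he⟩ := hγ.eventually.self_of_nhds
  rw [horoFactor_of_eq h hwa he]
  exact ⟨ht, he⟩

lemma continuousAt_horoFactor (hγ : IsHoroLift Ψ Ξ x w γ r) (h : IsNullMapPair ε Ψ Ξ) :
    ContinuousAt (fun s => horoFactor Ψ Ξ x (γ s)) r := by
  have h1 : ContinuousAt (fun s => Ψ (γ s)) r :=
    h.smooth_left.continuous.continuousAt.comp hγ.contMDiffAt.continuousAt
  have h2 : ContinuousAt (fun s => mink (Ψ (γ s)) (Ξ x)) r :=
    continuous_mink.continuousAt.comp (h1.prodMk continuousAt_const)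
  exact h2.neg.div_const 2

/-- The speed of a lift equals the conformal factor. -/
lemma speed (hγ : IsHoroLift Ψ Ξ x w γ r) (h : IsNullMapPair ε Ψ Ξ) (hw : mink w w = 1)
    (hwp : mink w (Ψ x) = 0) (hwa : mink w (Ξ x) = 0) :
    mink (dMink Ψ (γ r) (mfderiv 𝓘(ℝ, ℝ) (𝓡 n) γ r (1 : ℝ)))
      (dMink Ψ (γ r) (mfderiv 𝓘(ℝ, ℝ) (𝓡 n) γ r (1 : ℝ))) = horoFactor Ψ Ξ x (γ r) ^ 2 := by
  set D := dMink Ψ (γ r) (mfderiv 𝓘(ℝ, ℝ) (𝓡 n) γ r (1 : ℝ)) with hD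
  have hd : HasDerivAt (fun s => Ψ (γ s)) D r :=
    hasDerivAt_comp_dMink (h.mdiff_left _) hγ.mdiff
  have hlam : HasDerivAt (fun s => horoFactor Ψ Ξ x (γ s)) (-mink D (Ξ x) / 2) r := by
    have := ((hd.mink (hasDerivAt_const r (Ξ x))).fun_neg).div_const 2
    simpa [mink_zero_right, horoFactor] using this
  have hd' := hlam.smul (hasDerivAt_horoLine (Ψ x) (Ξ x) w r)
  have heq : (fun s => Ψ (γ s)) =ᶠ[𝓝 r]
      fun s => horoFactor Ψ Ξ x (γ s) • horoLine (Ψ x) (Ξ x) w s := by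
    filter_upwards [hγ.eventually] with s hs
    obtain ⟨t, ht, he⟩ := hs
    rw [horoFactor_of_eq h hwa he, he]
  have hDe := hd.unique (hd'.congr_of_eventuallyEq heq)
  have hnp := h.nullPair x
  have e1 := mink_horoLine_self hnp hw hwp hwa r
  have e2 : mink (horoLine (Ψ x) (Ξ x) w r) (w + (r / 2) • Ξ x) = 0 := by
    simp only [horoLine, mink_add_left, mink_add_right, mink_smul_left, mink_smul_right, hw, hwa,
      mink_comm (Ψ x) w, mink_comm (Ξ x) w, hwp, hnp.right, hnp.pairing]
    ring
  have e3 : mink (w + (r / 2) • Ξ x) (w + (r / 2) • Ξ x) = 1 := by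
    simp only [mink_add_left, mink_add_right, mink_smul_left, mink_smul_right, hw, hwa,
      mink_comm (Ξ x) w, hnp.right]
    ring
  rw [hDe]
  simp only [mink_add_left, mink_add_right, mink_smul_left, mink_smul_right] at e1 e2 e3 ⊢
  rw [mink_comm _ (horoLine (Ψ x) (Ξ x) w r), mink_comm _ (horoLine (Ψ x) (Ξ x) w r)]
  linear_combination (mink D (Ξ x) / 2) ^ 2 * e1 - horoFactor Ψ Ξ x (γ r) * mink D (Ξ x) * e2 +
    horoFactor Ψ Ξ x (γ r) ^ 2 * e3

end IsHoroLift

/-- The conformal factor stays close to `1` along a lift on which it is at most `2`. -/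
lemma IsNullMapPair.horoFactor_estimate (h : IsNullMapPair ε Ψ Ξ) (hε : 0 ≤ ε) {x : M}
    {w : Mink n} (hw : mink w w = 1) (hwp : mink w (Ψ x) = 0) (hwa : mink w (Ξ x) = 0)
    {γ : ℝ → M} {s : ℝ} (hs : 0 ≤ s) (hγ : ∀ r ∈ Icc 0 s, IsHoroLift Ψ Ξ x w γ r)
    (h2 : ∀ r ∈ Icc 0 s, horoFactor Ψ Ξ x (γ r) ≤ 2) :
    |horoFactor Ψ Ξ x (γ s) - 1| ≤ 4 * ε * s ^ 2 := by
  have h00 : (0 : ℝ) ∈ Icc 0 s := ⟨le_rfl, hs⟩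
  have hx0 : γ 0 = x := by
    refine h.eq_of_mink_eq_zero _ _ ?_
    rw [((hγ 0 h00).eq_horoFactor h hwa).2]
    simp [horoLine, mink_smul_left, (h.nullPair x).left]
  refine abs_mink_add_one_le (P := fun r => Ψ (γ r)) (X := fun r => Ξ (γ r))
    (P' := fun r => dMink Ψ (γ r) (mfderiv 𝓘(ℝ, ℝ) (𝓡 n) γ r (1 : ℝ)))
    (X' := fun r => dMink Ξ (γ r) (mfderiv 𝓘(ℝ, ℝ) (𝓡 n) γ r (1 : ℝ)))
    (a := Ξ x) hε hs ?_ ?_ (fun r _ => h.nullPair _) (fun r _ => h.right_pos _)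
    (h.nullPair x).right (h.right_pos x) (fun r _ => h.dleft_left _ _) (fun r _ => h.orth _ _)
    (fun r _ => h.dright_left _ _) (fun r _ => h.dright_right _ _) (fun r _ => h.bound _ _)
    ?_ ?_ ?_ ?_ ?_
  · exact fun r hr => hasDerivAt_comp_dMink (h.mdiff_left _) (hγ r hr).mdiff
  · exact fun r hr => hasDerivAt_comp_dMink (h.mdiff_right _) (hγ r hr).mdiff
  · intro r hr
    rw [(hγ r hr).speed h hw hwp hwa]
    have h3 := h2 r hr
    have h4 := ((hγ r hr).eq_horoFactor h hwa).1
    nlinarith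
  · intro r hr
    have h3 := h2 r hr
    rw [horoFactor, mink_comm] at h3
    linarith
  · intro r hr
    have h3 := ((hγ r hr).eq_horoFactor h hwa).1
    rw [horoFactor, mink_comm] at h3
    linarith
  · simp [hx0, (h.nullPair x).pairing]
  · simp [hx0, (h.nullPair x).right]

/-- Straight lines of the horosphere model lift to `M`, as long as their length is small compared
with `ε ^ (-1 / 2)`. -/
lemma IsNullMapPair.exists_lift_horoLine [IsManifold (𝓡 n) ∞ M] (h : IsNullMapPair ε Ψ Ξ)
    (hcomp : HasCompleteMetric Ψ) (hε : 0 ≤ ε) {x : M}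
    {w : Mink n} (hw : mink w w = 1) (hwp : mink w (Ψ x) = 0) (hwa : mink w (Ξ x) = 0)
    {S : ℝ} (hS : 0 ≤ S) (hεS : ε * S ^ 2 ≤ 1 / 100) :
    ∃ z, ∃ t : ℝ, 0 < t ∧ Ψ z = t • horoLine (Ψ x) (Ξ x) w S ∧ |t - 1| ≤ 4 * ε * S ^ 2 := by
  classical
  set c := horoLine (Ψ x) (Ξ x) w with hc
  have hnp := h.nullPair x
  have hc0 := mink_horoLine_self hnp hw hwp hwa
  set γ : ℝ → M := fun r => if hr : ∃ q, ∃ t : ℝ, 0 < t ∧ Ψ q = t • c r then hr.choose else x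
    with hγdef
  have hγ : ∀ r, (∃ q, ∃ t : ℝ, 0 < t ∧ Ψ q = t • c r) → ∃ t : ℝ, 0 < t ∧ Ψ (γ r) = t • c r := by
    intro r hr
    simp only [hγdef, dif_pos hr]
    exact hr.choose_spec
  set Good : ℝ → Prop := fun r => ∃ q, ∃ t : ℝ, 1 / 2 ≤ t ∧ t ≤ 2 ∧ Ψ q = t • c r with hGood
  have hlift : ∀ r, Good r → IsHoroLift Ψ Ξ x w γ r := by
    rintro r ⟨q, t, ht, -, hq⟩
    have := h.lift_contMDiffAt (contDiff_horoLine (Ψ x) (Ξ x) w) hc0 hγ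
      (r₀ := r) ⟨q, t, by linarith, hq⟩
    exact ⟨this.1, this.2⟩
  have hfac : ∀ r, Good r → 1 / 2 ≤ horoFactor Ψ Ξ x (γ r) ∧ horoFactor Ψ Ξ x (γ r) ≤ 2 := by
    rintro r hr
    have h1 := (hlift r hr).eq_horoFactor h hwa
    obtain ⟨q, t, ht, ht2, hq⟩ := hr
    have : γ r = q := by
      refine h.eq_of_mink_eq_zero _ _ ?_
      rw [h1.2, hq, mink_smul_left, mink_smul_right, show mink _ (c r) = 0 from hc0 r]
      ring
    rw [this, horoFactor_of_eq h hwa hq]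
    exact ⟨ht, ht2⟩
  have hg0 : Good 0 := ⟨x, 1, by norm_num, by norm_num, by simp [hc, horoLine]⟩
  have hopen : ∀ b, 0 ≤ b → b ≤ S → (∀ r ∈ Icc 0 b, Good r) → ∀ᶠ r in 𝓝 b, Good r := by
    intro b hb hbS hgb
    have hest := h.horoFactor_estimate hε hw hwp hwa hb (fun r hr => hlift r (hgb r hr))
      (fun r hr => (hfac r (hgb r hr)).2)
    have hb4 : 4 * ε * b ^ 2 ≤ 1 / 25 := by
      have : ε * b ^ 2 ≤ ε * S ^ 2 := by gcongr
      linarith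
    have hest' := abs_le.1 (hest.trans hb4)
    have hL := hlift b (hgb b ⟨hb, le_rfl⟩)
    have hcont := hL.continuousAt_horoFactor h
    filter_upwards [hL.eventually, hcont.eventually_const_lt (u := 1 / 2) (by linarith),
      hcont.eventually_lt_const (u := 2) (by linarith)] with r hr h1 h2
    obtain ⟨t, ht, he⟩ := hr
    rw [horoFactor_of_eq h hwa he] at h1 h2
    exact ⟨γ r, t, h1.le, h2.le, he⟩
  have hclosed : ∀ b, 0 < b → (∀ r ∈ Ico 0 b, Good r) → Good b := by
    intro b hb hgb
    obtain ⟨N, C, hN, hC, hsmul, hle⟩ := hcomp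
    obtain ⟨u, q, hu, hub, huq⟩ := hN.exists_tendsto hsmul (γ := γ) (K := C * 2) hb
      (fun r hr => (hlift r (hgb r hr)).contMDiffAt) (by
        intro r hr
        refine (hle _ _).trans ?_
        rw [(hlift r (hgb r hr)).speed h hw hwp hwa]
        have h1 := hfac r (hgb r hr)
        rw [Real.sqrt_sq (by linarith)]
        exact mul_le_mul_of_nonneg_left h1.2 hC)
    have hΨq : Tendsto (fun k => Ψ (γ (u k))) atTop (𝓝 (Ψ q)) :=
      (h.smooth_left.continuous.tendsto q).comp huq
    have hfq : Tendsto (fun k => horoFactor Ψ Ξ x (γ (u k))) atTop (𝓝 (horoFactor Ψ Ξ x q)) := by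
      have h2 : Tendsto (fun k => mink (Ψ (γ (u k))) (Ξ x)) atTop (𝓝 (mink (Ψ q) (Ξ x))) :=
        (continuous_mink.tendsto (Ψ q, Ξ x)).comp (hΨq.prodMk_nhds tendsto_const_nhds)
      exact h2.neg.div_const 2
    have hcb : Tendsto (fun k => c (u k)) atTop (𝓝 (c b)) :=
      ((contDiff_horoLine (Ψ x) (Ξ x) w).continuous.tendsto b).comp hub
    refine ⟨q, horoFactor Ψ Ξ x q, ge_of_tendsto' hfq fun k => (hfac _ (hgb _ (hu k))).1,
      le_of_tendsto' hfq fun k => (hfac _ (hgb _ (hu k))).2, ?_⟩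
    refine tendsto_nhds_unique hΨq ((hfq.smul hcb).congr fun k => ?_)
    exact ((hlift _ (hgb _ (hu k))).eq_horoFactor h hwa).2.symm
  have hall : ∀ r ∈ Icc 0 S, Good r := by
    set T : Set ℝ := {s | s ∈ Icc 0 S ∧ ∀ r ∈ Icc 0 s, Good r} with hT
    have hT0 : (0 : ℝ) ∈ T := ⟨⟨le_rfl, hS⟩, fun r hr => by
      rw [le_antisymm hr.2 hr.1]; exact hg0⟩
    have hTb : BddAbove T := ⟨S, fun s hs => hs.1.2⟩
    set b := sSup T with hb
    have hb0 : 0 ≤ b := le_csSup hTb hT0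
    have hbS : b ≤ S := csSup_le ⟨0, hT0⟩ fun s hs => hs.1.2
    have hIco : ∀ r ∈ Ico 0 b, Good r := by
      intro r hr
      obtain ⟨s, hs, hrs⟩ := exists_lt_of_lt_csSup ⟨0, hT0⟩ hr.2
      exact hs.2 r ⟨hr.1, hrs.le⟩
    have hgb : Good b := by
      rcases hb0.eq_or_lt with h0 | h0
      · rw [← h0]; exact hg0
      · exact hclosed b h0 hIco
    have hIcc : ∀ r ∈ Icc 0 b, Good r := by
      intro r hr
      rcases hr.2.eq_or_lt with h0 | h0
      · rw [h0]; exact hgb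
      · exact hIco r ⟨hr.1, h0⟩
    rcases hbS.eq_or_lt with h0 | h0
    · rw [← h0]; exact hIcc
    · exfalso
      obtain ⟨δ, hδ, hball⟩ := Metric.eventually_nhds_iff.1 (hopen b hb0 hbS hIcc)
      set s := min S (b + δ / 2) with hs
      have hbs : b < s := lt_min h0 (by linarith)
      have hsT : s ∈ T := by
        refine ⟨⟨hb0.trans hbs.le, min_le_left _ _⟩, fun r hr => ?_⟩
        rcases le_or_gt r b with h1 | h1
        · exact hIcc r ⟨hr.1, h1⟩
        · refine hball ?_
          have : r ≤ b + δ / 2 := hr.2.trans (min_le_right _ _)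
          rw [Real.dist_eq, abs_of_pos (by linarith)]
          linarith
      exact absurd (le_csSup hTb hsT) (not_le.2 hbs)
  have hest := h.horoFactor_estimate hε hw hwp hwa hS (fun r hr => hlift r (hall r hr))
    (fun r hr => (hfac r (hall r hr)).2)
  have hfin := (hlift S (hall S ⟨hS, le_rfl⟩)).eq_horoFactor h hwa
  exact ⟨γ S, _, hfin.1, hfin.2, hest⟩

/-- Null directions at bounded distance in the horosphere model at `x` lie in the image of the
Gauss map, and the light cone map is close to the model there. -/
lemma IsNullMapPair.exists_lift [IsManifold (𝓡 n) ∞ M] (h : IsNullMapPair ε Ψ Ξ)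
    (hcomp : HasCompleteMetric Ψ) (hε : 0 ≤ ε) (x : M) {c : Mink n} (hc : mink c c = 0)
    (hca : mink c (Ξ x) = -2) (hεu : ε * (-2 * mink c (Ψ x)) ≤ 1 / 100) :
    ∃ z, ∃ t : ℝ, 0 < t ∧ Ψ z = t • c ∧ |t - 1| ≤ 4 * ε * (-2 * mink c (Ψ x)) := by
  have hnp := h.nullPair x
  have hc0 : 0 < c.1 := by
    by_contra! hneg
    have h1 : mink (-c) (Ξ x) = 2 := by rw [mink_neg_left, hca]; norm_num
    rcases hneg.eq_or_lt with h0 | h0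
    · have : c = 0 := by
        rw [mink_self, h0] at hc
        exact Prod.ext h0 (by simpa using hc)
      rw [this, mink_zero_left] at hca
      norm_num at hca
    · have := mink_nonpos_of_null (p := -c) (q := Ξ x) (by simp [mink_neg_left, mink_neg_right, hc])
        (by simpa using h0) hnp.right (h.right_pos x)
      linarith
  have hcp : mink c (Ψ x) ≤ 0 := mink_nonpos_of_null hc hc0 hnp.left (h.left_pos x)
  rcases hcp.eq_or_lt with h0 | h0
  · have h1 := eq_smul_of_null hc hc0 hnp.left (h.left_pos x) h0
    have h2 : (Ψ x).1 / c.1 = 1 := by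
      have h3 := hnp.pairing
      rw [h1, mink_smul_left, hca] at h3
      linarith
    rw [h2] at h1
    exact ⟨x, 1, one_pos, h1, by simp [h0]⟩
  · set u := Real.sqrt (-2 * mink c (Ψ x)) with hu
    have hupos : 0 < u := Real.sqrt_pos.2 (by linarith)
    have hu2 : u ^ 2 = -2 * mink c (Ψ x) := Real.sq_sqrt (by linarith)
    have hcu : mink c (Ψ x) = -(u ^ 2 / 2) := by linarith
    set w : Mink n := u⁻¹ • (c - Ψ x - (u ^ 2 / 4) • Ξ x) with hwdef
    have hline : horoLine (Ψ x) (Ξ x) w u = c := by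
      rw [horoLine, hwdef, smul_smul, mul_inv_cancel₀ hupos.ne', one_smul]
      abel
    have hww : mink w w = 1 := by
      simp only [hwdef, mink_smul_left, mink_smul_right, mink_sub_left, mink_sub_right, hc, hca,
        hcu, mink_comm (Ψ x) c, mink_comm (Ξ x) c, hnp.left, hnp.right, hnp.pairing,
        hnp.symm.pairing]
      field_simp; ring
    have hwp : mink w (Ψ x) = 0 := by
      simp only [hwdef, mink_smul_left, mink_sub_left, hcu, hnp.left, hnp.symm.pairing]
      ring
    have hwa : mink w (Ξ x) = 0 := by
      simp only [hwdef, mink_smul_left, mink_sub_left, hca, hnp.right, hnp.pairing]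
      ring
    obtain ⟨z, t, ht, hz, hest⟩ := h.exists_lift_horoLine hcomp hε hww hwp hwa hupos.le
      (by rw [hu2]; exact hεu)
    rw [hline] at hz
    rw [hu2] at hest
    exact ⟨z, t, ht, hz, hest⟩

end Lift

section Embedding

variable {n : ℕ} {M : Type*} [TopologicalSpace M] [ChartedSpace (EuclideanSpace ℝ (Fin n)) M]
  {ε : ℝ} {Ψ Ξ : M → Mink n}

/-- Cauchy-Schwarz for the components of two vectors orthogonal to a null frame. -/
lemma IsNullPair.mink_add_sq_le {p q : Mink n} (h : IsNullPair p q) (y z : Mink n) :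
    (mink y z + (mink y p * mink z q + mink y q * mink z p) / 2) ^ 2 ≤
      (mink y y + mink y p * mink y q) * (mink z z + mink z p * mink z q) := by
  have hpq := h.pairing
  have hqp := h.symm.pairing
  have hpp := h.left
  have hqq := h.right
  have e := h.mink_sq_le (d := y + (mink y q / 2) • p + (mink y p / 2) • q)
    (by simp only [mink_add_left, mink_smul_left, hpp, hqp]; ring)
    (by simp only [mink_add_left, mink_smul_left, hqq, hpq]; ring) z
  simp only [mink_add_left, mink_add_right, mink_smul_left, mink_smul_right, hpq, hqp, hpp,
    hqq, mink_comm p y, mink_comm q y, mink_comm p z, mink_comm q z] at e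
  calc _ = (mink y z + mink y q / 2 * mink z p + mink y p / 2 * mink z q) ^ 2 := by ring
    _ ≤ _ := e
    _ = _ := by ring

lemma real_bounds_of_frames {f g l l' : ℝ} (hf : 0 ≤ f) (hg : 0 ≤ g) (hl : 0 ≤ l) (hl' : 0 ≤ l')
    (hsum : f ^ 2 + g ^ 2 + 2 * l ^ 2 + 2 * l' ^ 2 < 4 + 4 / 1000) (hl1 : l ^ 2 < 1 / 1000)
    (hcs : (-2 + (f ^ 2 * g ^ 2 + 4 * (l ^ 2 * l' ^ 2)) / 2) ^ 2 ≤
      4 * (f ^ 2 * g ^ 2 * l ^ 2 * l' ^ 2)) :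
    l' ≤ 8 / 100 ∧ 18 / 10 ≤ g ^ 2 ∧ g ^ 2 ≤ 22 / 10 := by
  have hfg : 0 ≤ f * g := mul_nonneg hf hg
  have hll : 0 ≤ l * l' := mul_nonneg hl hl'
  have h1 : 2 ≤ f * g + 2 * (l * l') := by
    have h2 : (-2 + (f ^ 2 * g ^ 2 + 4 * (l ^ 2 * l' ^ 2)) / 2) ^ 2 ≤
        (2 * (f * g * (l * l'))) ^ 2 := hcs.trans_eq (by ring)
    have h3 := abs_le_of_sq_le_sq' h2 (by positivity)
    by_contra! hlt
    have h4 : (f * g + 2 * (l * l')) ^ 2 < 2 ^ 2 := by gcongr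
    nlinarith [h3.1]
  have h2 : (l - l') ^ 2 < 2 / 1000 := by nlinarith [sq_nonneg (f - g)]
  have h3 : l ≤ 32 / 1000 := by nlinarith
  have h4 : l' - l ≤ 45 / 1000 := by nlinarith
  have h5 : l' ≤ 8 / 100 := by linarith
  have h6 : l * l' ≤ 32 / 1000 * (8 / 100) := by gcongr
  have h7 : (f - g) ^ 2 ≤ 4 / 1000 := by nlinarith [sq_nonneg (l - l')]
  have h8 := abs_le_of_sq_le_sq' (h7.trans (by norm_num : _ ≤ (64 / 1000 : ℝ) ^ 2)) (by norm_num)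
  refine ⟨h5, ?_, ?_⟩
  · by_contra! hlt
    have : g ≤ 135 / 100 := by nlinarith
    nlinarith [h8.2]
  · by_contra! hlt
    have : 148 / 100 ≤ g := by nlinarith
    nlinarith [h8.1]

lemma IsNullMapPair.horoFactor_nonneg (h : IsNullMapPair ε Ψ Ξ) (x y : M) :
    0 ≤ horoFactor Ψ Ξ x y := by
  have := mink_nonpos_of_null (h.nullPair y).left (h.left_pos y) (h.nullPair x).right
    (h.right_pos x)
  rw [horoFactor]; linarith

lemma IsNullMapPair.abs_horoFactor_sub_one_le [IsManifold (𝓡 n) ∞ M] (h : IsNullMapPair ε Ψ Ξ)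
    (hcomp : HasCompleteMetric Ψ) (hε : 0 ≤ ε) {x y : M} (hpos : 0 < horoFactor Ψ Ξ x y)
    (hle : ε * (2 * -mink (Ψ x) (Ψ y) / horoFactor Ψ Ξ x y) ≤ 1 / 100) :
    |horoFactor Ψ Ξ x y - 1| ≤ 4 * ε * (2 * -mink (Ψ x) (Ψ y) / horoFactor Ψ Ξ x y) := by
  set l := horoFactor Ψ Ξ x y with hl
  have hyx : mink (Ψ y) (Ξ x) = -2 * l := by rw [hl, horoFactor]; ring
  have hyy := (h.nullPair y).left
  have e : -2 * mink (l⁻¹ • Ψ y) (Ψ x) = 2 * -mink (Ψ x) (Ψ y) / l := by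
    rw [mink_smul_left, mink_comm (Ψ y)]; field_simp
  obtain ⟨z, t, ht, hz, hest⟩ := h.exists_lift hcomp hε x (c := l⁻¹ • Ψ y)
    (by simp [mink_smul_left, mink_smul_right, hyy])
    (by rw [mink_smul_left, hyx]; field_simp) (by rw [e]; exact hle)
  have hzy : z = y := h.eq_of_mink_eq_zero _ _ (by
    rw [hz]; simp [mink_smul_left, hyy])
  have htl : t = l := by
    rw [hl, horoFactor, ← hzy, hz, mink_smul_left, mink_smul_left, hyx]; field_simp
  rw [e, htl] at hest
  exact hest

lemma IsNullMapPair.exists_unit_tangent (h : IsNullMapPair ε Ψ Ξ) (hn : 1 ≤ n) (x : M) :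
    ∃ w, mink w w = 1 ∧ mink w (Ψ x) = 0 ∧ mink w (Ξ x) = 0 := by
  obtain ⟨v, hv⟩ : ∃ v : EuclideanSpace ℝ (Fin n), v ≠ 0 := by
    have : Nonempty (Fin n) := ⟨⟨0, hn⟩⟩
    exact exists_ne 0
  obtain ⟨d, hd⟩ : ∃ d, d = dMink Ψ x v := ⟨_, rfl⟩
  have hpos : 0 < mink d d := hd ▸ h.spacelike x v hv
  have hd1 : mink d (Ψ x) = 0 := hd ▸ h.dleft_left x v
  have hd2 : mink d (Ξ x) = 0 := hd ▸ h.orth x v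
  have hs : Real.sqrt (mink d d) ^ 2 = mink d d := Real.sq_sqrt hpos.le
  have hs0 : 0 < Real.sqrt (mink d d) := Real.sqrt_pos.2 hpos
  refine ⟨(Real.sqrt (mink d d))⁻¹ • d, ?_, ?_, ?_⟩
  · rw [mink_smul_left, mink_smul_right]
    nth_rw 3 [← hs]
    field_simp
  · rw [mink_smul_left, hd1, mul_zero]
  · rw [mink_smul_left, hd2, mul_zero]

lemma four_mul_mink_half (a b c d : Mink n) :
    4 * mink ((1 / 2 : ℝ) • (a + b)) ((1 / 2 : ℝ) • (c + d)) =
      mink a c + mink b d + mink a d + mink b c := by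
  simp only [mink_smul_left, mink_smul_right, mink_add_left, mink_add_right]; ring

/-- Two points that are close in hyperbolic space cannot have almost opposite light cone maps. -/
lemma IsNullMapPair.le_horoFactor [IsManifold (𝓡 n) ∞ M] (h : IsNullMapPair ε Ψ Ξ)
    (hn : 1 ≤ n) (hcomp : HasCompleteMetric Ψ) (hε : 0 ≤ ε) (hε1 : ε ≤ 1 / 10 ^ 6) {x y : M}
    (hD : -mink ((1 / 2 : ℝ) • (Ψ x + Ξ x)) ((1 / 2 : ℝ) • (Ψ y + Ξ y)) - 1 < 1 / 1000) :
    1 / 1000 ≤ horoFactor Ψ Ξ x y := by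
  by_contra! hlt
  obtain ⟨w, hww, hwp, hwa⟩ := h.exists_unit_tangent hn x
  have hx := h.nullPair x
  have hy := h.nullPair y
  have hF : 0 ≤ -mink (Ψ x) (Ψ y) :=
    neg_nonneg.2 (mink_nonpos_of_null hx.left (h.left_pos x) hy.left (h.left_pos y))
  have hT : 0 ≤ -mink (Ξ x) (Ξ y) :=
    neg_nonneg.2 (mink_nonpos_of_null hx.right (h.right_pos x) hy.right (h.right_pos y))
  have hl := h.horoFactor_nonneg x y
  have hl' := h.horoFactor_nonneg y x
  have e4 := four_mul_mink_half (Ψ x) (Ξ x) (Ψ y) (Ξ y)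
  have e1 : mink (Ψ y) (Ξ x) = -2 * horoFactor Ψ Ξ x y := by rw [horoFactor]; ring
  have e2 : mink (Ψ x) (Ξ y) = -2 * horoFactor Ψ Ξ y x := by rw [horoFactor]; ring
  obtain ⟨f, hf, hfF⟩ : ∃ f : ℝ, 0 ≤ f ∧ mink (Ψ x) (Ψ y) = -f ^ 2 :=
    ⟨_, Real.sqrt_nonneg _, by rw [Real.sq_sqrt hF]; ring⟩
  obtain ⟨g, hg, hgT⟩ : ∃ g : ℝ, 0 ≤ g ∧ mink (Ξ x) (Ξ y) = -g ^ 2 :=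
    ⟨_, Real.sqrt_nonneg _, by rw [Real.sq_sqrt hT]; ring⟩
  obtain ⟨l, hl0, hll⟩ : ∃ l : ℝ, 0 ≤ l ∧ horoFactor Ψ Ξ x y = l ^ 2 :=
    ⟨_, Real.sqrt_nonneg _, (Real.sq_sqrt hl).symm⟩
  obtain ⟨l', hl0', hll'⟩ : ∃ l : ℝ, 0 ≤ l ∧ horoFactor Ψ Ξ y x = l ^ 2 :=
    ⟨_, Real.sqrt_nonneg _, (Real.sq_sqrt hl').symm⟩
  rw [hll] at e1 hlt
  rw [hll'] at e2
  rw [hfF, hgT, e2, mink_comm (Ξ x), e1] at e4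
  have hsum : f ^ 2 + g ^ 2 + 2 * l ^ 2 + 2 * l' ^ 2 < 4 + 4 / 1000 := by linarith
  have hcs := hx.mink_add_sq_le (Ψ y) (Ξ y)
  rw [hy.left, hy.right, hy.pairing, e1, mink_comm (Ψ y), mink_comm (Ξ y), mink_comm (Ξ y), hfF,
    hgT, e2] at hcs
  obtain ⟨b1, b2, b3⟩ := real_bounds_of_frames hf hg hl0 hl0' hsum hlt
    (le_of_eq_of_le (by ring) (hcs.trans_eq (by ring)))
  have hw1 := hx.mink_add_sq_le w (Ξ y)
  rw [hww, hwp, hwa, hy.right, mink_comm (Ξ y), mink_comm (Ξ y), hgT, e2] at hw1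
  have hw1' : mink w (Ξ y) ^ 2 ≤ (17 / 100) ^ 2 := by
    have : l' ^ 2 * g ^ 2 ≤ (8 / 100) ^ 2 * (22 / 10) := by gcongr
    linarith
  have hw1'' := abs_le_of_sq_le_sq' hw1' (by norm_num)
  have hw2 := hx.mink_add_sq_le w (Ψ y)
  rw [hww, hwp, hwa, hy.left, mink_comm (Ψ y) (Ψ x), hfF, e1] at hw2
  have hw2' : mink w (Ψ y) ^ 2 ≤ (1 / 10) ^ 2 := by
    have : f ^ 2 * l ^ 2 ≤ (4 + 4 / 1000) * (1 / 1000) := by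
      gcongr
      linarith [sq_nonneg g, sq_nonneg l, sq_nonneg l']
    linarith
  have hw2'' := abs_le_of_sq_le_sq' hw2' (by norm_num)
  set Z := horoLine (Ψ x) (Ξ x) w 1 with hZ
  have hZZ : mink Z Z = 0 := mink_horoLine_self hx hww hwp hwa 1
  have hZx : mink Z (Ξ x) = -2 := mink_horoLine_right hx hwa 1
  have hZp : mink Z (Ψ x) = -(1 ^ 2 / 2) := mink_horoLine_left hx hwp 1
  have hZy : mink Z (Ξ y) = -2 * l' ^ 2 + mink w (Ξ y) - g ^ 2 / 4 := by
    simp only [hZ, horoLine, mink_add_left, mink_smul_left, e2, hgT]; ring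
  have hZq : mink Z (Ψ y) = -f ^ 2 + mink w (Ψ y) - l ^ 2 / 2 := by
    simp only [hZ, horoLine, mink_add_left, mink_smul_left, hfF, mink_comm (Ξ x) (Ψ y), e1]; ring
  set k := -mink Z (Ξ y) with hk
  have hl2 : l' ^ 2 ≤ (8 / 100) ^ 2 := by gcongr
  have hk1 : 1 / 4 ≤ k := by linarith [sq_nonneg l', hw1''.2]
  have hk2 : k ≤ 3 / 4 := by linarith
  have hq1 : -mink Z (Ψ y) ≤ 5 := by
    linarith [sq_nonneg g, sq_nonneg l, sq_nonneg l', hw2''.1]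
  have hkpos : 0 < k := by linarith
  obtain ⟨z, t, ht, hz, hest⟩ := h.exists_lift hcomp hε x hZZ hZx (by rw [hZp]; linarith)
  have e5 : -2 * mink ((2 / k) • Z) (Ψ y) ≤ 80 := by
    rw [mink_smul_left]
    have : 2 / k ≤ 8 := by rw [div_le_iff₀ hkpos]; linarith
    calc -2 * (2 / k * mink Z (Ψ y)) = 2 / k * (2 * -mink Z (Ψ y)) := by ring
      _ ≤ 2 / k * 10 := by gcongr; linarith
      _ ≤ 8 * 10 := by gcongr
      _ = 80 := by norm_num
  have e6 : ε * (-2 * mink ((2 / k) • Z) (Ψ y)) ≤ 1 / 10 ^ 6 * 80 :=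
    (mul_le_mul_of_nonneg_left e5 hε).trans (by gcongr)
  obtain ⟨z', t', ht', hz', hest'⟩ := h.exists_lift hcomp hε y (c := (2 / k) • Z)
    (by simp [mink_smul_left, mink_smul_right, hZZ])
    (by rw [mink_smul_left, show mink Z (Ξ y) = -k by rw [hk]; ring]; field_simp)
    (e6.trans (by norm_num))
  have hzz : z = z' := h.eq_of_mink_eq_zero _ _ (by
    rw [hz, hz']; simp [mink_smul_left, mink_smul_right, hZZ])
  have htt : t = t' * (2 / k) := by
    have h1 : mink (Ψ z) (Ξ x) = mink (Ψ z') (Ξ x) := by rw [hzz]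
    rw [hz, hz', mink_smul_left, mink_smul_left, mink_smul_left, hZx] at h1
    linarith
  have hk' : 2 ≤ 2 / k := by rw [le_div_iff₀ hkpos]; linarith
  have h1 := (abs_le.1 hest).2
  have h2 := (abs_le.1 hest').1
  rw [hZp] at h1
  have h3 : 9 / 10 ≤ t' := by linarith
  have h4 : t ≤ 11 / 10 := by linarith
  have h5 : 9 / 10 * 2 ≤ t' * (2 / k) := by gcongr
  linarith

/-- Distances between nearby points of the hypersurface control the light cone map. -/
lemma IsNullMapPair.neg_mink_le [IsManifold (𝓡 n) ∞ M] (h : IsNullMapPair ε Ψ Ξ)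
    (hn : 1 ≤ n) (hcomp : HasCompleteMetric Ψ) (hε : 0 ≤ ε) (hε1 : ε ≤ 1 / 10 ^ 6) {x y : M}
    (hD : -mink ((1 / 2 : ℝ) • (Ψ x + Ξ x)) ((1 / 2 : ℝ) • (Ψ y + Ξ y)) - 1 < 1 / 1000) :
    -mink (Ψ x) (Ψ y) ≤
      8 * (-mink ((1 / 2 : ℝ) • (Ψ x + Ξ x)) ((1 / 2 : ℝ) • (Ψ y + Ξ y)) - 1) := by
  have hl := h.le_horoFactor hn hcomp hε hε1 hD
  have hl' := h.le_horoFactor (x := y) (y := x) hn hcomp hε hε1 (by rwa [mink_comm])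
  have hx := h.nullPair x
  have hy := h.nullPair y
  have hF : 0 ≤ -mink (Ψ x) (Ψ y) :=
    neg_nonneg.2 (mink_nonpos_of_null hx.left (h.left_pos x) hy.left (h.left_pos y))
  have hT : 0 ≤ -mink (Ξ x) (Ξ y) :=
    neg_nonneg.2 (mink_nonpos_of_null hx.right (h.right_pos x) hy.right (h.right_pos y))
  have e4 := four_mul_mink_half (Ψ x) (Ξ x) (Ψ y) (Ξ y)
  have e1 : mink (Ξ x) (Ψ y) = -2 * horoFactor Ψ Ξ x y := by rw [mink_comm, horoFactor]; ring
  have e2 : mink (Ψ x) (Ξ y) = -2 * horoFactor Ψ Ξ y x := by rw [horoFactor]; ring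
  rw [e1, e2] at e4
  set F := -mink (Ψ x) (Ψ y) with hFdef
  have hbound : ∀ t : ℝ, 1 / 1000 ≤ t → ε * (2 * F / t) ≤ 1 / 10 ^ 6 * (2000 * F) := by
    intro t ht
    have ht0 : 0 < t := by linarith
    have : 2 * F / t ≤ 2000 * F := by rw [div_le_iff₀ ht0]; nlinarith
    have h0 : 0 ≤ 2 * F / t := by positivity
    gcongr
  have hF5 : F ≤ 5 := by linarith
  have b1 := hbound _ hl
  have b2 := hbound _ hl'
  have a1 := (abs_le.1 (h.abs_horoFactor_sub_one_le hcomp hε (x := x) (y := y) (by linarith)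
    (b1.trans (by linarith)))).1
  have a2 := (abs_le.1 (h.abs_horoFactor_sub_one_le hcomp hε (x := y) (y := x) (by linarith)
    (by rw [mink_comm (Ψ y)]; exact b2.trans (by linarith)))).1
  rw [mink_comm (Ψ y), ← hFdef] at a2
  rw [← hFdef] at a1
  have h1 : mink (Ψ x) (Ψ y) = -F := by rw [hFdef]; ring
  linarith

end Embedding

section Embedding

variable {n : ℕ} {M : Type*} [TopologicalSpace M] [ChartedSpace (EuclideanSpace ℝ (Fin n)) M]
  {ε : ℝ} {Ψ Ξ : M → Mink n}

lemma dMink_add {φ ψ : M → Mink n} {p : M} (hφ : MDifferentiableAt (𝓡 n) 𝓘(ℝ, Mink n) φ p)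
    (hψ : MDifferentiableAt (𝓡 n) 𝓘(ℝ, Mink n) ψ p) (v : TangentSpace (𝓡 n) p) :
    dMink (fun q => φ q + ψ q) p v = dMink φ p v + dMink ψ p v :=
  DFunLike.congr_fun (hφ.hasMFDerivAt.add hψ.hasMFDerivAt).mfderiv v

lemma dMink_sub {φ ψ : M → Mink n} {p : M} (hφ : MDifferentiableAt (𝓡 n) 𝓘(ℝ, Mink n) φ p)
    (hψ : MDifferentiableAt (𝓡 n) 𝓘(ℝ, Mink n) ψ p) (v : TangentSpace (𝓡 n) p) :
    dMink (fun q => φ q - ψ q) p v = dMink φ p v - dMink ψ p v :=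
  DFunLike.congr_fun (hφ.hasMFDerivAt.sub hψ.hasMFDerivAt).mfderiv v

lemma dMink_const_smul {φ : M → Mink n} {p : M}
    (hφ : MDifferentiableAt (𝓡 n) 𝓘(ℝ, Mink n) φ p) (c : ℝ) (v : TangentSpace (𝓡 n) p) :
    dMink (fun q => c • φ q) p v = c • dMink φ p v :=
  DFunLike.congr_fun (hφ.hasMFDerivAt.const_smul c).mfderiv v

/-- Convergence of null directions implies convergence in `M`. -/
lemma IsNullMapPair.tendsto_of_mink [IsManifold (𝓡 n) ∞ M] (h : IsNullMapPair ε Ψ Ξ) (x : M)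
    {l : Filter M} (hF : Tendsto (fun y => mink (Ψ x) (Ψ y)) l (𝓝 0)) {B : ℝ}
    (hB : ∀ᶠ y in l, (Ψ x).1 / (Ψ y).1 ≤ B) : Tendsto id l (𝓝 x) := by
  have hxx := (h.nullPair x).left
  have hx0 := h.left_pos x
  set Y : M → Mink n := fun y => ((Ψ x).1 / (Ψ y).1) • Ψ y with hY
  have hY1 : ∀ y, (Y y).1 = (Ψ x).1 := fun y => by
    simp only [hY, Prod.smul_fst, smul_eq_mul]
    exact div_mul_cancel₀ _ (h.left_pos y).ne'
  have hYn : ∀ y, mink (Y y) (Y y) = 0 := fun y => by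
    simp [hY, mink_smul_left, mink_smul_right, (h.nullPair y).left]
  have hd : ∀ y, ‖(Y y).2 - (Ψ x).2‖ ^ 2 = -2 * (((Ψ x).1 / (Ψ y).1) * mink (Ψ x) (Ψ y)) := by
    intro y
    have e1 : mink (Y y - Ψ x) (Y y - Ψ x) = -2 * (((Ψ x).1 / (Ψ y).1) * mink (Ψ x) (Ψ y)) := by
      rw [mink_sub_left, mink_sub_right, mink_sub_right, hYn, hxx, mink_comm (Y y)]
      simp only [hY, mink_smul_right]; ring
    rw [mink_self, Prod.fst_sub, hY1, sub_self] at e1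
    simpa using e1
  have hlim : Tendsto (fun y => ‖(Y y).2 - (Ψ x).2‖ ^ 2) l (𝓝 0) := by
    have h2 : Tendsto (fun y => 2 * B * -mink (Ψ x) (Ψ y)) l (𝓝 0) := by
      simpa using (hF.neg).const_mul (2 * B)
    refine squeeze_zero' (Eventually.of_forall fun y => by positivity) ?_ h2
    filter_upwards [hB] with y hy
    rw [hd]
    have hneg : 0 ≤ -mink (Ψ x) (Ψ y) := neg_nonneg.2
      (mink_nonpos_of_null hxx hx0 (h.nullPair y).left (h.left_pos y))
    nlinarith [mul_le_mul_of_nonneg_right hy hneg]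
  have hY2 : Tendsto (fun y => (Y y).2) l (𝓝 (Ψ x).2) := by
    rw [tendsto_iff_norm_sub_tendsto_zero]
    have := (Real.continuous_sqrt.tendsto 0).comp hlim
    simpa [Function.comp_def, Real.sqrt_sq] using this
  have hYt : Tendsto Y l (𝓝 (Ψ x)) :=
    (show Tendsto (fun y => (Y y).1) l (𝓝 (Ψ x).1) by
      simp only [hY1]; exact tendsto_const_nhds).prodMk_nhds hY2
  obtain ⟨k, hk0, hks, hk⟩ := h.exists_local_section x
  have hkt : Tendsto (fun y => k (Y y)) l (𝓝 x) := by
    have := hks.self_of_nhds.continuousAt.tendsto.comp hYt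
    rwa [hk0] at this
  refine hkt.congr' ?_
  filter_upwards [hYt.eventually hk] with y hy
  obtain ⟨r, hr, he⟩ := hy (hYn y)
  refine h.eq_of_mink_eq_zero _ _ ?_
  have h1 : r * mink (Ψ (k (Y y))) (Y y) = 0 := by rw [← mink_smul_left, ← he, hYn]
  have h2 : mink (Ψ (k (Y y))) (Y y) = 0 := (mul_eq_zero.1 h1).resolve_left hr.ne'
  simp only [hY, mink_smul_right] at h2
  exact (mul_eq_zero.1 h2).resolve_left (div_pos hx0 (h.left_pos y)).ne'

/-- If `ε` is small enough, the hypersurface with light cone maps `Ψ` and `Ξ` is embedded. -/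
theorem IsNullMapPair.isEmbeddedHyp [IsManifold (𝓡 n) ∞ M] (h : IsNullMapPair ε Ψ Ξ)
    (hn : 1 ≤ n) (hcomp : HasCompleteMetric Ψ) (hε : 0 ≤ ε) (hε1 : ε ≤ 1 / 10 ^ 6) :
    IsEmbeddedHyp fun p => (1 / 2 : ℝ) • (Ψ p + Ξ p) := by
  have hsum : ContMDiff (𝓡 n) 𝓘(ℝ, Mink n) ∞ fun p => Ψ p + Ξ p :=
    h.smooth_left.add h.smooth_right
  have hsm : ContMDiff (𝓡 n) 𝓘(ℝ, Mink n) ∞ fun p => (1 / 2 : ℝ) • (Ψ p + Ξ p) :=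
    (contDiff_const_smul (1 / 2 : ℝ)).contMDiff.comp hsum
  have hself := fun x => h.mink_half_half x
  refine ⟨⟨h.half_mem_hyp, hsm, fun p => ?_⟩, ?_⟩
  · rw [injective_iff_map_eq_zero]
    intro v hv
    by_contra hv0
    rw [dMink_const_smul ((hsum.mdifferentiable (by simp)) p),
      dMink_add (h.mdiff_left p) (h.mdiff_right p)] at hv
    have h1 : dMink Ξ p v = -dMink Ψ p v := by
      have := (smul_eq_zero.1 hv).resolve_left (by norm_num)
      exact (neg_eq_of_add_eq_zero_right this).symm
    have h2 := h.bound p v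
    rw [h1, mink_neg_left, mink_neg_right, neg_neg] at h2
    have h3 := h.spacelike p v hv0
    have h4 : ε ^ 2 ≤ 1 / 2 := by nlinarith
    nlinarith
  · have hinj : Function.Injective fun p => (1 / 2 : ℝ) • (Ψ p + Ξ p) := by
      intro x y hxy
      simp only at hxy
      have h0 : -mink ((1 / 2 : ℝ) • (Ψ x + Ξ x)) ((1 / 2 : ℝ) • (Ψ y + Ξ y)) - 1 = 0 := by
        rw [← hxy, hself]; norm_num
      have h1 := h.neg_mink_le hn hcomp hε hε1 (x := x) (y := y) (by rw [h0]; norm_num)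
      rw [h0, mul_zero] at h1
      refine h.eq_of_mink_eq_zero _ _ (le_antisymm ?_ (by linarith))
      exact mink_nonpos_of_null (h.nullPair x).left (h.left_pos x) (h.nullPair y).left
        (h.left_pos y)
    refine ⟨isInducing_iff_nhds.2 fun x => le_antisymm hsm.continuous.continuousAt.tendsto.le_comap
      ?_, hinj⟩
    set φ : M → Mink n := fun p => (1 / 2 : ℝ) • (Ψ p + Ξ p) with hφ
    have hφt : Tendsto φ (comap φ (𝓝 (φ x))) (𝓝 (φ x)) := tendsto_comap
    have hD : Tendsto (fun y => -mink (φ x) (φ y) - 1) (comap φ (𝓝 (φ x))) (𝓝 0) := by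
      have h1 : Tendsto (fun y => mink (φ x) (φ y)) (comap φ (𝓝 (φ x)))
          (𝓝 (mink (φ x) (φ x))) :=
        (continuous_mink.tendsto (φ x, φ x)).comp (tendsto_const_nhds.prodMk_nhds hφt)
      rw [hself] at h1
      simpa using h1.neg.sub_const 1
    refine tendsto_id'.1 (h.tendsto_of_mink x (l := comap φ (𝓝 (φ x))) (B := (Ψ x).1 * (2 * ((φ x).1 + 1))) ?_ ?_)
    · have h8 : Tendsto (fun y => -(8 * (-mink (φ x) (φ y) - 1))) (comap φ (𝓝 (φ x))) (𝓝 0) := by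
        simpa using (hD.const_mul 8).neg
      refine tendsto_of_tendsto_of_tendsto_of_le_of_le' h8 tendsto_const_nhds ?_ ?_
      · filter_upwards [hD.eventually_lt_const (u := 1 / 1000) (by norm_num)] with y hy
        have := h.neg_mink_le hn hcomp hε hε1 hy
        linarith
      · exact Eventually.of_forall fun y => mink_nonpos_of_null (h.nullPair x).left (h.left_pos x)
          (h.nullPair y).left (h.left_pos y)
    · have h1 : Tendsto (fun y => (φ y).1) (comap φ (𝓝 (φ x))) (𝓝 (φ x).1) :=
        (continuous_fst.tendsto _).comp hφt
      filter_upwards [h1.eventually_lt_const (u := (φ x).1 + 1) (by linarith)] with y hy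
      have hy1 := h.left_pos y
      have hy2 := h.right_pos y
      have h3 : 1 ≤ (Ψ y).1 * (Ξ y).1 := by
        have h4 := neg_le_of_abs_le (abs_real_inner_le_norm (Ψ y).2 (Ξ y).2)
        rw [norm_snd_eq_of_null (h.nullPair y).left hy1,
          norm_snd_eq_of_null (h.nullPair y).right hy2] at h4
        have h5 := (h.nullPair y).pairing
        simp only [mink] at h5
        linarith
      have h6 : (Ξ y).1 ≤ 2 * ((φ x).1 + 1) := by
        have : (φ y).1 = 1 / 2 * ((Ψ y).1 + (Ξ y).1) := by simp [hφ]; ring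
        linarith
      rw [div_le_iff₀ hy1]
      have h7 : 1 ≤ (Ψ y).1 * (2 * ((φ x).1 + 1)) := h3.trans (by gcongr)
      have := mul_le_mul_of_nonneg_left h7 (h.left_pos x).le
      linarith

end Embedding

section Flow

variable {n : ℕ} {M : Type*} [TopologicalSpace M] [ChartedSpace (EuclideanSpace ℝ (Fin n)) M]
  {ε : ℝ} {Ψ Ξ : M → Mink n}

lemma IsNullMapPair.exp_smul (h : IsNullMapPair ε Ψ Ξ) (t : ℝ) :
    IsNullMapPair (ε * Real.exp (-t) * Real.exp (-t)) (fun p => Real.exp t • Ψ p)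
      (fun p => Real.exp (-t) • Ξ p) := by
  have hmul : Real.exp t * Real.exp (-t) = 1 := by rw [← Real.exp_add]; simp
  have hl : ∀ p v, dMink (fun p => Real.exp t • Ψ p) p v = Real.exp t • dMink Ψ p v :=
    fun p v => dMink_const_smul (h.mdiff_left p) _ v
  have hr : ∀ p v, dMink (fun p => Real.exp (-t) • Ξ p) p v = Real.exp (-t) • dMink Ξ p v :=
    fun p v => dMink_const_smul (h.mdiff_right p) _ v
  refine ⟨(contDiff_const_smul (Real.exp t)).contMDiff.comp h.smooth_left,
    (contDiff_const_smul (Real.exp (-t))).contMDiff.comp h.smooth_right, fun p => ⟨?_, ?_, ?_⟩,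
    fun p => ?_, fun p => ?_, fun p v => ?_, fun p => ?_, fun p v => ?_, fun p q hpq => ?_⟩
  · simp [mink_smul_left, mink_smul_right, (h.nullPair p).left]
  · simp [mink_smul_left, mink_smul_right, (h.nullPair p).right]
  · rw [mink_smul_left, mink_smul_right, (h.nullPair p).pairing]
    linear_combination -2 * hmul
  · exact mul_pos (Real.exp_pos t) (h.left_pos p)
  · exact mul_pos (Real.exp_pos (-t)) (h.right_pos p)
  · rw [hl, mink_smul_left, mink_smul_right, h.orth]; ring
  · rw [injective_iff_map_eq_zero]
    intro v hv
    rw [hl] at hv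
    have h1 := (smul_eq_zero.1 hv).resolve_left (Real.exp_pos t).ne'
    exact h.immersion p (by rw [h1, map_zero])
  · rw [hl, hr]
    simp only [mink_smul_left, mink_smul_right]
    have h1 := h.bound p v
    calc Real.exp (-t) * (Real.exp (-t) * mink (dMink Ξ p v) (dMink Ξ p v))
        ≤ Real.exp (-t) * (Real.exp (-t) * (ε ^ 2 * mink (dMink Ψ p v) (dMink Ψ p v))) := by gcongr
      _ = (Real.exp t * Real.exp (-t)) ^ 2 * (Real.exp (-t) * (Real.exp (-t) *
          (ε ^ 2 * mink (dMink Ψ p v) (dMink Ψ p v)))) := by rw [hmul]; ring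
      _ = _ := by ring
  · simp only [mink_smul_left, mink_smul_right] at hpq
    have h1 := (mul_eq_zero.1 hpq).resolve_left (Real.exp_pos t).ne'
    exact h.eq_of_mink_eq_zero _ _ ((mul_eq_zero.1 h1).resolve_left (Real.exp_pos t).ne')

lemma HasCompleteMetric.exp_smul (h : IsNullMapPair ε Ψ Ξ) (hcomp : HasCompleteMetric Ψ) (t : ℝ) :
    HasCompleteMetric fun p => Real.exp t • Ψ p := by
  obtain ⟨N, C, hN, hC, hsmul, hle⟩ := hcomp
  refine ⟨N, C * Real.exp (-t), hN, by positivity, hsmul, fun p v => (hle p v).trans_eq ?_⟩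
  have hmul : Real.exp (-t) * Real.exp t = 1 := by rw [← Real.exp_add]; simp
  rw [dMink_const_smul (h.mdiff_left p), mink_smul_left, mink_smul_right, ← mul_assoc,
    Real.sqrt_mul (by positivity), Real.sqrt_mul_self (by positivity)]
  linear_combination -C * Real.sqrt (mink (dMink Ψ p v) (dMink Ψ p v)) * hmul

/-- The normal flow of a hypersurface with complete horospherical metric is eventually embedded. -/
theorem IsNullMapPair.exists_isEmbeddedHyp [IsManifold (𝓡 n) ∞ M] (h : IsNullMapPair ε Ψ Ξ)
    (hn : 1 ≤ n) (hcomp : HasCompleteMetric Ψ) (hε : 0 ≤ ε) :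
    ∃ t₀ : ℝ, ∀ t ≥ t₀, IsEmbeddedHyp fun p =>
      (1 / 2 : ℝ) • (Real.exp t • Ψ p + Real.exp (-t) • Ξ p) := by
  refine ⟨Real.log (10 ^ 6 * (ε + 1)), fun t ht => ?_⟩
  refine (h.exp_smul t).isEmbeddedHyp hn (hcomp.exp_smul h t) (by positivity) ?_
  have h1 : Real.exp (-t) ≤ (10 ^ 6 * (ε + 1))⁻¹ := by
    rw [Real.exp_neg]
    refine inv_anti₀ (by positivity) ?_
    rwa [← Real.log_le_iff_le_exp (by positivity)]
  have h2 : (10 ^ 6 * (ε + 1))⁻¹ ≤ 1 := inv_le_one_of_one_le₀ (by nlinarith)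
  calc ε * Real.exp (-t) * Real.exp (-t) ≤ (ε + 1) * (10 ^ 6 * (ε + 1))⁻¹ * 1 := by
        gcongr
        · linarith
        · exact h1.trans h2
    _ = 1 / 10 ^ 6 := by field_simp

end Flow

section Spectral

variable {n : ℕ} {V : Type*} [AddCommGroup V] [Module ℝ V] [FiniteDimensional ℝ V]

lemma exists_eigenbasis {A : V →ₗ[ℝ] Mink n} {u : Mink n} (hu : mink u u = -1)
    (hAu : ∀ v, mink u (A v) = 0) (hA : Function.Injective A) {S : V →ₗ[ℝ] V}
    (hS : ∀ v w, mink (A (S v)) (A w) = mink (A v) (A (S w))) :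
    ∃ (m : ℕ) (e : Module.Basis (Fin m) ℝ V) (κ : Fin m → ℝ),
      (∀ i j, mink (A (e i)) (A (e j)) = if i = j then 1 else 0) ∧ ∀ i, S (e i) = κ i • e i := by
  let core : InnerProductSpace.Core ℝ V :=
    { inner := fun v w => mink (A v) (A w)
      conj_inner_symm := fun v w => by simp [mink_comm]
      re_inner_nonneg := fun v => by
        simpa using mink_self_nonneg_of_orth hu (hAu v)
      add_left := fun v w z => by simp [mink_add_left]
      smul_left := fun v w c => by simp [mink_smul_left]
      definite := fun v hv => hA (by rw [eq_zero_of_orth hu (hAu v) hv, map_zero]) }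
  let _ : NormedAddCommGroup V := core.toNormedAddCommGroup
  let _ : InnerProductSpace ℝ V := InnerProductSpace.ofCore core.toCore
  have hsym : S.IsSymmetric := fun v w => hS v w
  set b := hsym.eigenvectorBasis rfl with hb
  refine ⟨_, b.toBasis, hsym.eigenvalues rfl, fun i j => ?_, fun i => ?_⟩
  · rw [OrthonormalBasis.coe_toBasis]
    exact b.inner_eq_ite i j
  · rw [OrthonormalBasis.coe_toBasis]
    exact hsym.apply_eigenvectorBasis rfl i

lemma mink_sum_smul_self {m : ℕ} {E : Fin m → Mink n}
    (hE : ∀ i j, mink (E i) (E j) = if i = j then 1 else 0) (a : Fin m → ℝ) :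
    mink (∑ i, a i • E i) (∑ i, a i • E i) = ∑ i, a i ^ 2 := by
  rw [← minkL_apply]
  simp only [map_sum, map_smul, FunLike.coe_sum, Finset.sum_apply, FunLike.coe_smul,
    Pi.smul_apply, minkL_apply, hE, smul_eq_mul]
  simp [sq]

/-- The differentials of the two light cone maps, compared through the shape operator. -/
lemma mink_shape_le (hV : Module.finrank ℝ V = n) {A B : V →ₗ[ℝ] Mink n} {u e : Mink n}
    (hu : mink u u = -1) (he : mink e e = 1) (heu : mink e u = 0)
    (hAu : ∀ v, mink u (A v) = 0) (hAe : ∀ v, mink e (A v) = 0)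
    (hBu : ∀ v, mink u (B v) = 0) (hBe : ∀ v, mink e (B v) = 0)
    (hA : Function.Injective A) (hsymm : ∀ v w, mink (B v) (A w) = mink (B w) (A v))
    {κ₀ : ℝ} (hκ₀ : -1 < κ₀) (hκ : ∀ κ : ℝ, (∃ v, v ≠ 0 ∧ B v = -(κ • A v)) → κ₀ ≤ κ) (v : V) :
    (1 + κ₀) ^ 2 * mink (A v) (A v) ≤ mink (A v - B v) (A v - B v) ∧
      mink (A v + B v) (A v + B v) ≤
        (2 / (1 + κ₀) + 1) ^ 2 * mink (A v - B v) (A v - B v) := by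
  set L : V × ℝ × ℝ →ₗ[ℝ] Mink n := A.comp (LinearMap.fst ℝ _ _) +
    ((LinearMap.fst ℝ ℝ ℝ).comp (LinearMap.snd ℝ _ _)).smulRight u +
    ((LinearMap.snd ℝ ℝ ℝ).comp (LinearMap.snd ℝ _ _)).smulRight e with hL
  have hLa : ∀ v r b, L (v, r, b) = A v + r • u + b • e := fun v r b => by simp [hL]
  have hpair : ∀ v r b, mink u (L (v, r, b)) = -r ∧ mink e (L (v, r, b)) = b := fun v r b => by
    simp [hLa, mink_add_right, mink_smul_right, hAu, hAe, hu, he, heu, mink_comm u e]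
  have hinj : Function.Injective L := by
    rw [injective_iff_map_eq_zero]
    rintro ⟨v, r, b⟩ hv
    obtain ⟨h1, h2⟩ := hpair v r b
    rw [hv, mink_zero_right] at h1 h2
    have hr : r = 0 := by linarith
    subst hr h2
    rw [hLa] at hv
    simp only [zero_smul, add_zero] at hv
    rw [hA (hv.trans (map_zero A).symm)]; rfl
  set L' := LinearEquiv.ofBijective L (linear_surjective_of_injective hV hinj) with hL'
  set S : V →ₗ[ℝ] V := -((LinearMap.fst ℝ V (ℝ × ℝ)).comp (L'.symm.toLinearMap.comp B)) with hS
  have hBS : ∀ v, B v = -A (S v) := by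
    intro v
    obtain ⟨⟨w, r, b⟩, hw⟩ := L'.surjective (B v)
    have hw' : L (w, r, b) = B v := hw
    have hSv : S v = -w := by
      simp [hS, ← hw]
    obtain ⟨h1, h2⟩ := hpair w r b
    rw [hw', hBu] at h1
    rw [hw', hBe] at h2
    have hr : r = 0 := by linarith
    subst hr h2
    rw [hSv, map_neg, neg_neg, ← hw', hLa]
    simp
  obtain ⟨m, E, κ, hE, hEκ⟩ := exists_eigenbasis (S := S) hu hAu hA (fun v w => by
    have := hsymm v w
    rw [hBS, hBS, mink_neg_left, mink_neg_left] at this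
    rw [neg_inj.1 this, mink_comm])
  have hκi : ∀ i, κ₀ ≤ κ i := fun i => hκ _ ⟨E i, E.ne_zero i, by rw [hBS, hEκ, map_smul]⟩
  set a := E.repr v with ha
  have hv : v = ∑ i, a i • E i := (E.sum_repr v).symm
  have hAv : A v = ∑ i, a i • A (E i) := by
    conv_lhs => rw [hv]
    simp
  have hBv : B v = ∑ i, (-(a i * κ i)) • A (E i) := by
    conv_lhs => rw [hv]
    simp [hBS, hEκ, smul_smul]
  have hsub : A v - B v = ∑ i, (a i * (1 + κ i)) • A (E i) := by
    rw [hAv, hBv, ← Finset.sum_sub_distrib]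
    refine Finset.sum_congr rfl fun i _ => ?_
    rw [← sub_smul]; congr 1; ring
  have hadd : A v + B v = ∑ i, (a i * (1 - κ i)) • A (E i) := by
    rw [hAv, hBv, ← Finset.sum_add_distrib]
    refine Finset.sum_congr rfl fun i _ => ?_
    rw [← add_smul]; congr 1; ring
  have hpos : 0 < 1 + κ₀ := by linarith
  rw [hsub, hadd, hAv, mink_sum_smul_self hE, mink_sum_smul_self hE, mink_sum_smul_self hE,
    Finset.mul_sum, Finset.mul_sum]
  constructor
  · refine Finset.sum_le_sum fun i _ => ?_
    rw [mul_pow, mul_comm]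
    have := hκi i
    gcongr
  · refine Finset.sum_le_sum fun i _ => ?_
    have h1 := hκi i
    have h2 : |1 - κ i| ≤ (2 / (1 + κ₀) + 1) * (1 + κ i) := by
      have h3 : 2 ≤ 2 / (1 + κ₀) * (1 + κ i) := by
        rw [div_mul_eq_mul_div, le_div_iff₀ hpos]; nlinarith
      rw [abs_le]; constructor <;> nlinarith
    have h4 : (1 - κ i) ^ 2 ≤ ((2 / (1 + κ₀) + 1) * (1 + κ i)) ^ 2 := sq_le_sq' (abs_le.1 h2).1
      (abs_le.1 h2).2
    calc (a i * (1 - κ i)) ^ 2 = a i ^ 2 * (1 - κ i) ^ 2 := by ring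
      _ ≤ a i ^ 2 * ((2 / (1 + κ₀) + 1) * (1 + κ i)) ^ 2 := by gcongr
      _ = _ := by ring

end Spectral

section Hypersurface

variable {n : ℕ} {M : Type*} [TopologicalSpace M] [ChartedSpace (EuclideanSpace ℝ (Fin n)) M]
  {φ η : M → Mink n}

lemma hasFDerivAt_comp_extChartAt_symm {p : M}
    (hφ : MDifferentiableAt (𝓡 n) 𝓘(ℝ, Mink n) φ p) :
    HasFDerivAt (fun z => φ ((extChartAt (𝓡 n) p).symm z))
      (show EuclideanSpace ℝ (Fin n) →L[ℝ] Mink n from dMink φ p) (extChartAt (𝓡 n) p p) := by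
  have h1 := hφ.hasMFDerivAt.2
  rw [ModelWithCorners.range_eq_univ] at h1
  exact hasFDerivWithinAt_univ.1 h1

lemma contDiffAt_comp_extChartAt_symm {m : ℕ∞ω} (hφ : ContMDiff (𝓡 n) 𝓘(ℝ, Mink n) m φ) (p : M) :
    ContDiffAt ℝ m (fun z => φ ((extChartAt (𝓡 n) p).symm z)) (extChartAt (𝓡 n) p p) := by
  have h1 := (contMDiffAt_iff.1 (hφ p)).2
  rwa [ModelWithCorners.range_eq_univ, contDiffWithinAt_univ] at h1

/-- The second fundamental form is symmetric. -/
lemma mink_dMink_symm [IsManifold (𝓡 n) ∞ M] (hφ : ContMDiff (𝓡 n) 𝓘(ℝ, Mink n) ∞ φ)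
    (hη : ContMDiff (𝓡 n) 𝓘(ℝ, Mink n) ∞ η) (h : ∀ q v, mink (η q) (dMink φ q v) = 0) (p : M)
    (v w : TangentSpace (𝓡 n) p) :
    mink (dMink η p v) (dMink φ p w) = mink (dMink η p w) (dMink φ p v) := by
  set e := extChartAt (𝓡 n) p with he
  set g : EuclideanSpace ℝ (Fin n) → Mink n := fun z => φ (e.symm z) with hg
  set k : EuclideanSpace ℝ (Fin n) → Mink n := fun z => η (e.symm z) with hk
  have hgd : ContDiffAt ℝ ∞ g (e p) := contDiffAt_comp_extChartAt_symm hφ p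
  have hgA := hasFDerivAt_comp_extChartAt_symm (hφ.mdifferentiable (by simp) p)
  have hkB := hasFDerivAt_comp_extChartAt_symm (hη.mdifferentiable (by simp) p)
  have hzero : ∀ w : EuclideanSpace ℝ (Fin n), ∀ᶠ z in 𝓝 (e p), mink (k z) (fderiv ℝ g z w) = 0 := by
    intro w
    filter_upwards [extChartAt_target_mem_nhds p] with z hz
    have h3 : MDifferentiableAt 𝓘(ℝ, EuclideanSpace ℝ (Fin n)) (𝓡 n) e.symm z :=
      ((contMDiffOn_extChartAt_symm (I := 𝓡 n) (n := ∞) p).contMDiffAt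
        ((isOpen_extChartAt_target p).mem_nhds hz)).mdifferentiableAt (by simp)
    have aux : ∀ A : EuclideanSpace ℝ (Fin n) →L[ℝ] Mink n, HasFDerivAt g A z →
        fderiv ℝ g z w = A w := fun A hA => by rw [hA.fderiv]
    obtain ⟨u, h5⟩ : ∃ u : TangentSpace (𝓡 n) (e.symm z),
        fderiv ℝ g z w = dMink φ (e.symm z) u :=
      ⟨mfderiv 𝓘(ℝ, EuclideanSpace ℝ (Fin n)) (𝓡 n) e.symm z w, aux _ (hasMFDerivAt_iff_hasFDerivAt.1
        (((hφ.mdifferentiable (by simp) (e.symm z)).hasMFDerivAt).comp z h3.hasMFDerivAt))⟩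
    rw [h5]
    exact h _ _
  have htwo : (2 : ℕ∞ω) ≤ ((⊤ : ℕ∞) : ℕ∞ω) :=
    WithTop.coe_le_coe.2 (le_top : (2 : ℕ∞) ≤ ⊤)
  have hg2 : DifferentiableAt ℝ (fderiv ℝ g) (e p) :=
    (hgd.fderiv_right (m := 1) htwo).differentiableAt (by simp)
  have hsym : IsSymmSndFDerivAt ℝ g (e p) := hgd.isSymmSndFDerivAt (by simpa using htwo)
  have key : ∀ v w : EuclideanSpace ℝ (Fin n),
      mink (k (e p)) (fderiv ℝ (fderiv ℝ g) (e p) v w) +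
        mink (fderiv ℝ k (e p) v) (fderiv ℝ g (e p) w) = 0 := by
    intro v w
    have h1 : HasFDerivAt (fun z => fderiv ℝ g z w)
        ((ContinuousLinearMap.apply ℝ (Mink n) w).comp (fderiv ℝ (fderiv ℝ g) (e p))) (e p) :=
      (ContinuousLinearMap.apply ℝ (Mink n) w).hasFDerivAt.comp (e p) hg2.hasFDerivAt
    have h2 : HasFDerivAt k (fderiv ℝ k (e p)) (e p) := hkB.differentiableAt.hasFDerivAt
    have h3 := (minkL n).hasFDerivAt_of_bilinear h2 h1
    have h4 : HasFDerivAt (fun z => minkL n (k z) (fderiv ℝ g z w))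
        (0 : EuclideanSpace ℝ (Fin n) →L[ℝ] ℝ) (e p) := by
      refine (hasFDerivAt_const (0 : ℝ) (e p)).congr_of_eventuallyEq ?_
      filter_upwards [hzero w] with z hz
      rw [minkL_apply, hz]
    have h5 := DFunLike.congr_fun (h3.unique h4) v
    simpa [minkL_apply] using h5
  have hfin : ∀ v w : EuclideanSpace ℝ (Fin n),
      mink (fderiv ℝ k (e p) v) (fderiv ℝ g (e p) w) =
        mink (fderiv ℝ k (e p) w) (fderiv ℝ g (e p) v) := by
    intro v w
    have h1 := key v w
    have h2 := key w v
    rw [hsym.eq v w] at h1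
    linarith
  have hfin' := hfin v w
  rw [hgA.fderiv, hkB.fderiv] at hfin'
  exact hfin'

lemma mink_shape_le_euclidean {A B : EuclideanSpace ℝ (Fin n) →L[ℝ] Mink n} {u e : Mink n}
    (hu : mink u u = -1) (he : mink e e = 1) (heu : mink e u = 0)
    (hAu : ∀ v, mink u (A v) = 0) (hAe : ∀ v, mink e (A v) = 0)
    (hBu : ∀ v, mink u (B v) = 0) (hBe : ∀ v, mink e (B v) = 0)
    (hA : Function.Injective A) (hsymm : ∀ v w, mink (B v) (A w) = mink (B w) (A v))
    {κ₀ : ℝ} (hκ₀ : -1 < κ₀) (hκ : ∀ κ : ℝ, (∃ v, v ≠ 0 ∧ B v = -(κ • A v)) → κ₀ ≤ κ)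
    (v : EuclideanSpace ℝ (Fin n)) :
    (1 + κ₀) ^ 2 * mink (A v) (A v) ≤ mink (A v - B v) (A v - B v) ∧
      mink (A v + B v) (A v + B v) ≤
        (2 / (1 + κ₀) + 1) ^ 2 * mink (A v - B v) (A v - B v) :=
  mink_shape_le (A := A.toLinearMap) (B := B.toLinearMap) finrank_euclideanSpace_fin hu he heu
    hAu hAe hBu hBe hA hsymm hκ₀ hκ v

/-- The light cone maps `φ - η` and `φ + η` of a uniformly weakly horospherically convex
hypersurface with injective Gauss map. -/
lemma exists_isNullMapPair [IsManifold (𝓡 n) ∞ M] (hφ : IsImmersedHyp φ) (hη : IsUnitNormal φ η)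
    (hκ : IsUniformlyWeaklyHoroConvex φ η) (hG : Function.Injective (gaussMap φ η)) :
    ∃ (κ₀ ε : ℝ), -1 < κ₀ ∧ 0 ≤ ε ∧
      IsNullMapPair ε (fun p => φ p - η p) (fun p => φ p + η p) ∧
      ∀ p v, (1 + κ₀) ^ 2 * mink (dMink φ p v) (dMink φ p v) ≤
        mink (dMink (fun p => φ p - η p) p v) (dMink (fun p => φ p - η p) p v) := by
  obtain ⟨κ₀, hκ₀, hκ⟩ := hκ
  have hφd : ∀ p, MDifferentiableAt (𝓡 n) 𝓘(ℝ, Mink n) φ p :=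
    fun p => hφ.smooth.mdifferentiable (by simp) p
  have hηd : ∀ p, MDifferentiableAt (𝓡 n) 𝓘(ℝ, Mink n) η p :=
    fun p => hη.smooth.mdifferentiable (by simp) p
  have hφφ : ∀ p, mink (φ p) (φ p) = -1 := fun p => (hφ.mem p).1
  have hφη : ∀ p, mink (φ p) (η p) = 0 := fun p => by rw [mink_comm, hη.tangent]
  have d1 : ∀ p v, mink (φ p) (dMink φ p v) = 0 := fun p v => by
    have := mink_dMink_add (hφd p) (hφd p) hφφ v
    rw [mink_comm (dMink φ p v)] at this; linarith
  have d2 : ∀ p v, mink (η p) (dMink η p v) = 0 := fun p v => by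
    have := mink_dMink_add (hηd p) (hηd p) hη.unit v
    rw [mink_comm (dMink η p v)] at this; linarith
  have d3 : ∀ p v, mink (φ p) (dMink η p v) = 0 := fun p v => by
    have := mink_dMink_add (hηd p) (hφd p) hη.tangent v
    rw [mink_comm (dMink η p v), hη.normal] at this; linarith
  have hshape := fun p v => mink_shape_le_euclidean (A := dMink φ p) (B := dMink η p) (hφφ p)
    (hη.unit p)
    (hη.tangent p) (d1 p) (hη.normal p) (d3 p) (d2 p) (hφ.immersion p)
    (mink_dMink_symm hφ.smooth hη.smooth hη.normal p) hκ₀ (fun κ hκ' => hκ p κ hκ') v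
  have hnull : ∀ p, IsNullPair (φ p - η p) (φ p + η p) := fun p => by
    refine ⟨?_, ?_, ?_⟩ <;>
    simp only [mink_sub_left, mink_sub_right, mink_add_left, mink_add_right, hφφ, hη.unit,
      hη.tangent, hφη] <;> norm_num
  have hpos : 0 < 1 + κ₀ := by linarith
  have hsub : ∀ p v, dMink (fun p => φ p - η p) p v = dMink φ p v - dMink η p v :=
    fun p v => dMink_sub (hφd p) (hηd p) v
  have hadd : ∀ p v, dMink (fun p => φ p + η p) p v = dMink φ p v + dMink η p v :=
    fun p v => dMink_add (hφd p) (hηd p) v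
  have hleft : ∀ p, 0 < (φ p - η p).1 := fun p => fst_pos_of_null (hnull p).left (hφ.mem p) (by
    rw [mink_sub_left, hφφ, hη.tangent]; norm_num)
  refine ⟨κ₀, 2 / (1 + κ₀) + 1, hκ₀, by positivity, ?_, fun p v => ?_⟩
  · refine ⟨hφ.smooth.sub hη.smooth, hφ.smooth.add hη.smooth, hnull, hleft, fun p => ?_,
      fun p v => ?_, fun p => ?_, fun p v => ?_, fun p q hpq => ?_⟩
    · exact fst_pos_of_null (hnull p).right (hφ.mem p) (by
        rw [mink_add_left, hφφ, hη.tangent]; norm_num)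
    · rw [hsub, mink_comm]
      simp only [mink_sub_right, mink_add_left, d1, d2, d3, hη.normal]; norm_num
    · rw [injective_iff_map_eq_zero]
      intro v hv
      have h1 := (hshape p v).1
      have h2 : mink (dMink φ p v - dMink η p v) (dMink φ p v - dMink η p v) = 0 := by
        rw [← hsub, hv, mink_zero_left]
      have h3 := mink_self_nonneg_of_orth (hφφ p) (d1 p v)
      have h4 : mink (dMink φ p v) (dMink φ p v) = 0 := by
        have h5 : (1 + κ₀) ^ 2 * mink (dMink φ p v) (dMink φ p v) ≤ 0 := h1.trans_eq h2
        have h6 : 0 < (1 + κ₀) ^ 2 := by positivity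
        nlinarith
      exact hφ.immersion p (by rw [eq_zero_of_orth (hφφ p) (d1 p v) h4, map_zero])
    · rw [hsub, hadd]
      exact (hshape p v).2
    · have h1 := eq_smul_of_null (hnull p).left (hleft p) (hnull q).left (hleft q) hpq
      refine hG ?_
      have hc : 0 < (φ q - η q).1 / (φ p - η p).1 := div_pos (hleft q) (hleft p)
      simp only [gaussMap]
      generalize (φ q - η q).1 / (φ p - η p).1 = c at h1 hc
      rw [h1, Prod.smul_fst, Prod.smul_snd, smul_smul, smul_eq_mul, mul_inv, mul_right_comm,
        inv_mul_cancel₀ hc.ne', one_mul]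
  · rw [hsub]
    exact (hshape p v).1

lemma normalFlow_eq {M : Type*} (φ η : M → Mink n) (t : ℝ) : normalFlow φ η t = fun p =>
    (1 / 2 : ℝ) • (Real.exp t • (φ p - η p) + Real.exp (-t) • (φ p + η p)) := by
  funext p
  rw [normalFlow, Real.cosh_eq, Real.sinh_eq]
  module

theorem exists_isEmbeddedHyp_normalFlow [IsManifold (𝓡 n) ∞ M] (hn : 1 ≤ n)
    (hφ : IsImmersedHyp φ) (hη : IsUnitNormal φ η) (hcomp : IsCompleteMetric (inducedNorm φ))
    (hκ : IsUniformlyWeaklyHoroConvex φ η) (hG : Function.Injective (gaussMap φ η)) :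
    ∃ t₀ : ℝ, ∀ t ≥ t₀, IsEmbeddedHyp (normalFlow φ η t) := by
  obtain ⟨κ₀, ε, hκ₀, hε, hpair, hle⟩ := exists_isNullMapPair hφ hη hκ hG
  have hpos : 0 < 1 + κ₀ := by linarith
  simp only [normalFlow_eq]
  refine hpair.exists_isEmbeddedHyp hn
    ⟨inducedNorm φ, (1 + κ₀)⁻¹, hcomp, by positivity, fun p c v => ?_, fun p v => ?_⟩ hε
  · rw [inducedNorm, map_smul, mink_smul_left, mink_smul_right, ← mul_assoc,
      Real.sqrt_mul (mul_self_nonneg c), Real.sqrt_mul_self_eq_abs]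
    rfl
  · rw [inducedNorm, inv_mul_eq_div, le_div_iff₀ hpos]
    refine Real.le_sqrt_of_sq_le ((le_of_eq ?_).trans (hle p v))
    have h1 : mink (φ p) (dMink φ p v) = 0 := by
      have := mink_dMink_add (hφ.smooth.mdifferentiable (by simp) p)
        (hφ.smooth.mdifferentiable (by simp) p) (fun q => (hφ.mem q).1) v
      rw [mink_comm (dMink φ p v)] at this; linarith
    rw [mul_pow, Real.sq_sqrt (mink_self_nonneg_of_orth (hφ.mem p).1 h1)]
    ring

end Hypersurface

section RadialExtension

variable {n : ℕ}

lemma radialExt_coe (ρ : Sph n → ℝ) (x : Sph n) :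
    radialExt ρ (x : EuclideanSpace ℝ (Fin (n + 1))) = ρ x := by
  have hx : ‖(x : EuclideanSpace ℝ (Fin (n + 1)))‖ = 1 := norm_eq_of_mem_sphere x
  have h : ‖(x : EuclideanSpace ℝ (Fin (n + 1)))‖⁻¹ • (x : EuclideanSpace ℝ (Fin (n + 1))) = x := by
    rw [hx]; simp
  rw [radialExt, dif_pos (by rw [h]; exact x.2)]
  congr 1
  exact Subtype.ext h

lemma radialExt_smul (ρ : Sph n → ℝ) {s : ℝ} (hs : 0 < s) (y : EuclideanSpace ℝ (Fin (n + 1))) :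
    radialExt ρ (s • y) = radialExt ρ y := by
  have h : ‖s • y‖⁻¹ • s • y = ‖y‖⁻¹ • y := by
    rw [norm_smul, Real.norm_of_nonneg hs.le, mul_inv, smul_smul, mul_right_comm,
      inv_mul_cancel₀ hs.ne', one_mul]
  have key : ∀ z z' : EuclideanSpace ℝ (Fin (n + 1)), z = z' →
      (open Classical in
        if h : z ∈ Metric.sphere (0 : EuclideanSpace ℝ (Fin (n + 1))) 1 then ρ ⟨z, h⟩ else 0) =
      (open Classical in
        if h : z' ∈ Metric.sphere (0 : EuclideanSpace ℝ (Fin (n + 1))) 1 then ρ ⟨z', h⟩ else 0) := by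
    rintro z _ rfl
    rfl
  exact key _ _ h

/-- The radially constant extension of a function that is smooth near a point of the sphere is
smooth near that point. -/
lemma contDiffAt_radialExt {ρ : Sph n → ℝ} {x : Sph n} (hρ : ContMDiffAt (𝓡 n) 𝓘(ℝ, ℝ) ∞ ρ x) :
    ContDiffAt ℝ ∞ (radialExt ρ) (x : EuclideanSpace ℝ (Fin (n + 1))) := by
  set U : TopologicalSpace.Opens (EuclideanSpace ℝ (Fin (n + 1))) := ⟨{0}ᶜ, isOpen_compl_singleton⟩
    with hU
  have hx : ‖(x : EuclideanSpace ℝ (Fin (n + 1)))‖ = 1 := norm_eq_of_mem_sphere x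
  have hxU : (x : EuclideanSpace ℝ (Fin (n + 1))) ∈ U := by
    intro h0
    rw [mem_singleton_iff.1 h0] at hx
    simp at hx
  have hmem : ∀ y : U, ‖(y : EuclideanSpace ℝ (Fin (n + 1)))‖⁻¹ •
      (y : EuclideanSpace ℝ (Fin (n + 1))) ∈ Metric.sphere 0 1 := by
    intro y
    have : ‖(y : EuclideanSpace ℝ (Fin (n + 1)))‖ ≠ 0 := norm_ne_zero_iff.2 y.2
    rw [mem_sphere_zero_iff_norm, norm_smul, norm_inv, norm_norm, inv_mul_cancel₀ this]
  have hsm : ContMDiff 𝓘(ℝ, EuclideanSpace ℝ (Fin (n + 1))) 𝓘(ℝ, EuclideanSpace ℝ (Fin (n + 1))) ∞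
      (fun y : U => ‖(y : EuclideanSpace ℝ (Fin (n + 1)))‖⁻¹ •
        (y : EuclideanSpace ℝ (Fin (n + 1)))) := by
    intro y
    refine (contMDiffAt_subtype_iff (U := U)
      (f := fun y : EuclideanSpace ℝ (Fin (n + 1)) => ‖y‖⁻¹ • y)).2 ?_
    have hy : (y : EuclideanSpace ℝ (Fin (n + 1))) ≠ 0 := y.2
    exact (((contDiffAt_norm ℝ hy).inv (norm_ne_zero_iff.2 hy)).smul contDiffAt_id).contMDiffAt
  have : Fact (Module.finrank ℝ (EuclideanSpace ℝ (Fin (n + 1))) = n + 1) := ⟨by simp⟩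
  have hν := hsm.codRestrict_sphere (n := n) hmem
  have hcomp : ContMDiffAt 𝓘(ℝ, EuclideanSpace ℝ (Fin (n + 1))) 𝓘(ℝ, ℝ) ∞
      (fun y : U => radialExt ρ y) ⟨x, hxU⟩ := by
    have heq : (fun y : U => radialExt ρ y) = ρ ∘ Set.codRestrict _ _ hmem := by
      funext y
      simp only [radialExt, dif_pos (hmem y)]
      rfl
    rw [heq]
    refine ContMDiffAt.comp _ ?_ hν.contMDiffAt
    have : Set.codRestrict _ _ hmem (⟨x, hxU⟩ : U) = x := by
      refine Subtype.ext ?_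
      simp [hx]
    rw [this]
    exact hρ
  exact (contMDiffAt_subtype_iff.1 hcomp).contDiffAt

variable {R : EuclideanSpace ℝ (Fin (n + 1)) → ℝ} {x v : EuclideanSpace ℝ (Fin (n + 1))}

lemma contDiffAt_gradient (hR : ContDiffAt ℝ ∞ R x) : ContDiffAt ℝ ∞ (gradient R) x :=
  (InnerProductSpace.toDual ℝ (EuclideanSpace ℝ (Fin (n + 1)))).symm.contDiff.contDiffAt.comp x
    (hR.fderiv_right (m := ∞) (by simp))

lemma inner_gradient_eq_fderiv (y w : EuclideanSpace ℝ (Fin (n + 1))) :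
    inner ℝ (gradient R y) w = fderiv ℝ R y w := by
  rw [gradient, InnerProductSpace.toDual_symm_apply]

lemma inner_gradient_radialExt {ρ : Sph n → ℝ} {y : EuclideanSpace ℝ (Fin (n + 1))}
    (hR : DifferentiableAt ℝ (radialExt ρ) y) : inner ℝ (gradient (radialExt ρ) y) y = 0 := by
  rw [inner_gradient_eq_fderiv]
  have h1 : HasDerivAt (fun s : ℝ => s • y) y 1 := by
    simpa using (hasDerivAt_id (1 : ℝ)).smul_const y
  have h2 : HasFDerivAt (radialExt ρ) (fderiv ℝ (radialExt ρ) y) ((1 : ℝ) • y) := by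
    rw [one_smul]; exact hR.hasFDerivAt
  have h3 := h2.comp_hasDerivAt (1 : ℝ) h1
  have h4 : HasDerivAt (radialExt ρ ∘ fun s : ℝ => s • y) 0 1 := by
    refine (hasDerivAt_const (1 : ℝ) (radialExt ρ y)).congr_of_eventuallyEq ?_
    filter_upwards [lt_mem_nhds (zero_lt_one' ℝ)] with s hs
    exact radialExt_smul ρ hs y
  exact h3.unique h4

lemma inner_fderiv_gradient_radialExt {ρ : Sph n → ℝ} (hR : ContDiffAt ℝ ∞ (radialExt ρ) x) :
    inner ℝ (fderiv ℝ (gradient (radialExt ρ)) x v) x = -inner ℝ (gradient (radialExt ρ) x) v := by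
  have h1 : HasFDerivAt (gradient (radialExt ρ)) (fderiv ℝ (gradient (radialExt ρ)) x) x :=
    ((contDiffAt_gradient hR).differentiableAt (by simp)).hasFDerivAt
  have h2 := h1.inner ℝ (hasFDerivAt_id x)
  have h3 : HasFDerivAt (fun y => inner ℝ (gradient (radialExt ρ) y) (id y))
      (0 : EuclideanSpace ℝ (Fin (n + 1)) →L[ℝ] ℝ) x := by
    refine (hasFDerivAt_const (0 : ℝ) x).congr_of_eventuallyEq ?_
    have hR1 : ContDiffAt ℝ 1 (radialExt ρ) x := hR.of_le (by simp)
    filter_upwards [hR1.eventually (by simp)] with y hy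
    exact inner_gradient_radialExt (hy.differentiableAt (by simp))
  have h4 := DFunLike.congr_fun (h2.unique h3) v
  rw [inner_gradient_eq_fderiv]
  simp at h4
  linarith

end RadialExtension

section LightCone

variable {n : ℕ}

/-- The light cone map `e^R (1, y)`. -/
def coneMap (R : EuclideanSpace ℝ (Fin (n + 1)) → ℝ) (y : EuclideanSpace ℝ (Fin (n + 1))) :
    Mink n :=
  Real.exp (R y) • ((1, y) : Mink n)

/-- The opposite light cone map `e^{-R} ((1 + |∇R|²) (1, y) + 2 (0, ∇R - y))`. -/
def oppConeMap (R : EuclideanSpace ℝ (Fin (n + 1)) → ℝ) (y : EuclideanSpace ℝ (Fin (n + 1))) :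
    Mink n :=
  Real.exp (-R y) • ((1 + ‖gradient R y‖ ^ 2) • ((1, y) : Mink n) +
    (2 : ℝ) • ((0, -y + gradient R y) : Mink n))

variable {R : EuclideanSpace ℝ (Fin (n + 1)) → ℝ} {x v : EuclideanSpace ℝ (Fin (n + 1))}

lemma contDiffAt_coneMap (hR : ContDiffAt ℝ ∞ R x) : ContDiffAt ℝ ∞ (coneMap R) x := by
  unfold coneMap
  exact hR.exp.smul (contDiffAt_const.prodMk contDiffAt_id)

lemma contDiffAt_oppConeMap (hR : ContDiffAt ℝ ∞ R x) : ContDiffAt ℝ ∞ (oppConeMap R) x := by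
  have hg := contDiffAt_gradient hR
  unfold oppConeMap
  have h1 : ContDiffAt ℝ ∞ (fun y : EuclideanSpace ℝ (Fin (n + 1)) =>
      ((0, -y + gradient R y) : Mink n)) x :=
    contDiffAt_const.prodMk (contDiffAt_id.neg.add hg)
  exact hR.neg.exp.smul (((contDiffAt_const.add (hg.norm_sq ℝ)).smul
    (contDiffAt_const.prodMk contDiffAt_id)).add (h1.const_smul (2 : ℝ)))

lemma fderiv_coneMap (hR : ContDiffAt ℝ ∞ R x) :
    fderiv ℝ (coneMap R) x v =
      Real.exp (R x) • ((inner ℝ (gradient R x) v, inner ℝ (gradient R x) v • x + v) : Mink n) := by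
  have h1 : HasFDerivAt R (fderiv ℝ R x) x := (hR.differentiableAt (by simp)).hasFDerivAt
  have h2 : HasFDerivAt (fun y : EuclideanSpace ℝ (Fin (n + 1)) => ((1, y) : Mink n))
      ((0 : EuclideanSpace ℝ (Fin (n + 1)) →L[ℝ] ℝ).prod (ContinuousLinearMap.id ℝ _)) x :=
    (hasFDerivAt_const (1 : ℝ) x).prodMk (hasFDerivAt_id x)
  have h3 := h1.exp.smul h2
  have h4 : HasFDerivAt (coneMap R) _ x := h3
  rw [h4.fderiv]
  refine Prod.ext ?_ ?_
  · simp
  · simp; module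

lemma fderiv_oppConeMap (hR : ContDiffAt ℝ ∞ R x) :
    fderiv ℝ (oppConeMap R) x v = Real.exp (-R x) •
      ((2 * inner ℝ (gradient R x) (fderiv ℝ (gradient R) x v) -
          inner ℝ (gradient R x) v * (1 + ‖gradient R x‖ ^ 2),
        (2 * inner ℝ (gradient R x) (fderiv ℝ (gradient R) x v) -
          inner ℝ (gradient R x) v * (1 + ‖gradient R x‖ ^ 2)) • x +
        ((‖gradient R x‖ ^ 2 - 1) • v + (2 : ℝ) • fderiv ℝ (gradient R) x v -
          (2 * inner ℝ (gradient R x) v) • (-x + gradient R x))) : Mink n) := by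
  have h1 : HasFDerivAt R (fderiv ℝ R x) x := (hR.differentiableAt (by simp)).hasFDerivAt
  have hg : HasFDerivAt (gradient R) (fderiv ℝ (gradient R) x) x :=
    ((contDiffAt_gradient hR).differentiableAt (by simp)).hasFDerivAt
  have h2 : HasFDerivAt (fun y : EuclideanSpace ℝ (Fin (n + 1)) => ((1, y) : Mink n))
      ((0 : EuclideanSpace ℝ (Fin (n + 1)) →L[ℝ] ℝ).prod (ContinuousLinearMap.id ℝ _)) x :=
    (hasFDerivAt_const (1 : ℝ) x).prodMk (hasFDerivAt_id x)
  have h3 : HasFDerivAt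
      (fun y : EuclideanSpace ℝ (Fin (n + 1)) => ((0, -y + gradient R y) : Mink n))
      ((0 : EuclideanSpace ℝ (Fin (n + 1)) →L[ℝ] ℝ).prod
        (-ContinuousLinearMap.id ℝ _ + fderiv ℝ (gradient R) x)) x :=
    (hasFDerivAt_const (0 : ℝ) x).prodMk ((hasFDerivAt_id x).fun_neg.add hg)
  have h5 := h1.fun_neg.exp.smul (((hg.norm_sq.const_add 1).smul h2).add (h3.const_smul (2 : ℝ)))
  have h4 : HasFDerivAt (oppConeMap R) _ x := h5
  rw [h4.fderiv]
  refine Prod.ext ?_ ?_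
  · simp; ring
  · simp
    module

end LightCone

section ConeAlgebra

variable {n : ℕ} {x v g : EuclideanSpace ℝ (Fin (n + 1))}

lemma mink_smul_prodMk_self (hx : inner ℝ x x = 1) (hv : inner ℝ x v = 0) (s a : ℝ) :
    mink (s • ((a, a • x + v) : Mink n)) (s • ((a, a • x + v) : Mink n)) =
      s ^ 2 * inner ℝ v v := by
  have hv' : inner ℝ v x = 0 := by rw [real_inner_comm, hv]
  simp only [mink, Prod.smul_fst, Prod.smul_snd, smul_eq_mul, inner_add_left, inner_add_right,
    real_inner_smul_left, real_inner_smul_right, hx, hv, hv']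
  ring

lemma mink_smul_prodMk_opp (hx : inner ℝ x x = 1) (hv : inner ℝ x v = 0) (hg : inner ℝ g x = 0)
    (s r : ℝ) :
    mink (s • ((inner ℝ g v, inner ℝ g v • x + v) : Mink n))
      (r • ((1 + ‖g‖ ^ 2) • ((1, x) : Mink n) + (2 : ℝ) • ((0, -x + g) : Mink n))) = 0 := by
  have hv' : inner ℝ v x = 0 := by rw [real_inner_comm, hv]
  have hg' : inner ℝ x g = 0 := by rw [real_inner_comm, hg]
  have hgv : inner ℝ v g = inner ℝ g v := real_inner_comm _ _
  simp only [mink, Prod.smul_fst, Prod.smul_snd, Prod.fst_add, Prod.snd_add, smul_eq_mul,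
    inner_add_left, inner_add_right, inner_neg_right,
    real_inner_smul_left, real_inner_smul_right, hx, hv', hg', hgv]
  ring

lemma isNullPair_cone (hx : inner ℝ x x = 1) (hg : inner ℝ g x = 0) {s r : ℝ} (hsr : s * r = 1) :
    IsNullPair (s • ((1, x) : Mink n))
      (r • ((1 + ‖g‖ ^ 2) • ((1, x) : Mink n) + (2 : ℝ) • ((0, -x + g) : Mink n))) := by
  have hg' : inner ℝ x g = 0 := by rw [real_inner_comm, hg]
  refine ⟨?_, ?_, ?_⟩ <;>
  simp only [mink, Prod.smul_fst, Prod.smul_snd, Prod.fst_add, Prod.snd_add, smul_eq_mul,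
    inner_add_left, inner_add_right, inner_neg_right, inner_neg_left,
    real_inner_smul_left, real_inner_smul_right, hx, hg', hg, real_inner_self_eq_norm_sq g]
  · ring
  · ring
  · linear_combination (-2 : ℝ) * hsr

end ConeAlgebra

section Inclusion

variable {n : ℕ} {Ω : TopologicalSpace.Opens (Sph n)}

lemma contMDiff_incl : ContMDiff (𝓡 n) 𝓘(ℝ, EuclideanSpace ℝ (Fin (n + 1))) ∞
    (fun y : Ω => ((y : Sph n) : EuclideanSpace ℝ (Fin (n + 1)))) := by
  have : Fact (Module.finrank ℝ (EuclideanSpace ℝ (Fin (n + 1))) = n + 1) := ⟨by simp⟩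
  exact contMDiff_coe_sphere.comp contMDiff_subtype_val

lemma hasMFDerivAt_incl (x : Ω) : HasMFDerivAt (𝓡 n) 𝓘(ℝ, EuclideanSpace ℝ (Fin (n + 1)))
    (fun y : Ω => ((y : Sph n) : EuclideanSpace ℝ (Fin (n + 1)))) x (dIncl Ω x) :=
  (contMDiff_incl.mdifferentiable (by simp) x).hasMFDerivAt

lemma inner_self_incl (x : Ω) :
    inner ℝ ((x : Sph n) : EuclideanSpace ℝ (Fin (n + 1))) ((x : Sph n) :
      EuclideanSpace ℝ (Fin (n + 1))) = 1 := by
  rw [real_inner_self_eq_norm_sq, norm_eq_of_mem_sphere, one_pow]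

lemma dMink_comp_incl {F : EuclideanSpace ℝ (Fin (n + 1)) → Mink n} {x : Ω}
    (hF : DifferentiableAt ℝ F ((x : Sph n) : EuclideanSpace ℝ (Fin (n + 1))))
    (v : TangentSpace (𝓡 n) x) :
    dMink (fun y : Ω => F ((y : Sph n) : EuclideanSpace ℝ (Fin (n + 1)))) x v =
      fderiv ℝ F ((x : Sph n) : EuclideanSpace ℝ (Fin (n + 1))) (dIncl Ω x v) := by
  have h := HasMFDerivAt.comp x hF.hasFDerivAt.hasMFDerivAt (hasMFDerivAt_incl x)
  exact DFunLike.congr_fun h.mfderiv v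

lemma inner_dIncl (x : Ω) (v : TangentSpace (𝓡 n) x) :
    inner ℝ ((x : Sph n) : EuclideanSpace ℝ (Fin (n + 1))) (dIncl Ω x v) = 0 := by
  have h1 : HasFDerivAt (fun y : EuclideanSpace ℝ (Fin (n + 1)) => ‖y‖ ^ 2) _
      ((x : Sph n) : EuclideanSpace ℝ (Fin (n + 1))) :=
    (hasStrictFDerivAt_norm_sq _).hasFDerivAt
  have h2 := HasMFDerivAt.comp x h1.hasMFDerivAt (hasMFDerivAt_incl x)
  have h3 : HasMFDerivAt (𝓡 n) 𝓘(ℝ, ℝ)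
      ((fun y : EuclideanSpace ℝ (Fin (n + 1)) => ‖y‖ ^ 2) ∘
        fun y : Ω => ((y : Sph n) : EuclideanSpace ℝ (Fin (n + 1)))) x 0 := by
    have : ((fun y : EuclideanSpace ℝ (Fin (n + 1)) => ‖y‖ ^ 2) ∘
        fun y : Ω => ((y : Sph n) : EuclideanSpace ℝ (Fin (n + 1)))) = fun _ => (1 : ℝ) := by
      funext y
      simp [norm_eq_of_mem_sphere]
    rw [this]
    exact hasMFDerivAt_const _ _
  have h4 := DFunLike.congr_fun (hasMFDerivAt_unique h2 h3) v
  have h5 : (2 : ℕ) • inner ℝ ((x : Sph n) : EuclideanSpace ℝ (Fin (n + 1))) (dIncl Ω x v) = 0 := h4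
  simpa using h5

lemma dIncl_injective (x : Ω) : Function.Injective (dIncl Ω x) := by
  have : Fact (Module.finrank ℝ (EuclideanSpace ℝ (Fin (n + 1))) = n + 1) := ⟨by simp⟩
  have h1 : Function.Injective (mfderiv (𝓡 n) 𝓘(ℝ, EuclideanSpace ℝ (Fin (n + 1)))
      ((↑) : Sph n → EuclideanSpace ℝ (Fin (n + 1))) x) := by
    convert! injective_mvfderiv_subtypeVal_sphere (x : Sph n)
  have h2 : MDifferentiableAt (𝓡 n) (𝓡 n) (Subtype.val : Ω → Sph n) x :=
    (contMDiff_subtype_val (n := ∞)).mdifferentiable (by simp) x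
  have h3 : Function.Injective (mfderiv (𝓡 n) (𝓡 n) (Subtype.val : Ω → Sph n) x) := by
    classical
    set f : Sph n → Ω := fun y => if h : y ∈ Ω then ⟨y, h⟩ else x with hf
    have hfid : (fun y : Ω => f y) = id := by
      funext y
      simp [hf]
    have hfs : MDifferentiableAt (𝓡 n) (𝓡 n) f (x : Sph n) := by
      have : ContMDiffAt (𝓡 n) (𝓡 n) ∞ (fun y : Ω => f y) x := by
        rw [hfid]; exact contMDiffAt_id
      exact (contMDiffAt_subtype_iff.1 this).mdifferentiableAt (by simp)
    have h4 := HasMFDerivAt.comp x hfs.hasMFDerivAt h2.hasMFDerivAt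
    have h5 : f ∘ (Subtype.val : Ω → Sph n) = id := hfid
    rw [h5] at h4
    have h6 := hasMFDerivAt_unique h4 (hasMFDerivAt_id x)
    intro v w hvw
    have h7 := DFunLike.congr_fun h6 v
    have h8 := DFunLike.congr_fun h6 w
    have h9 : ((mfderiv (𝓡 n) (𝓡 n) f (x : Sph n)).comp
      (mfderiv (𝓡 n) (𝓡 n) (Subtype.val : Ω → Sph n) x)) v =
      ((mfderiv (𝓡 n) (𝓡 n) f (x : Sph n)).comp
      (mfderiv (𝓡 n) (𝓡 n) (Subtype.val : Ω → Sph n) x)) w :=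
      congrArg (mfderiv (𝓡 n) (𝓡 n) f (x : Sph n)) hvw
    exact h7.symm.trans (h9.trans h8)
  have h4 := HasMFDerivAt.comp x
    (((contMDiff_coe_sphere (n := n) (m := ∞)).mdifferentiable (by simp)
      (x : Sph n)).hasMFDerivAt) h2.hasMFDerivAt
  have h5 := hasMFDerivAt_unique (hasMFDerivAt_incl x) h4
  intro v w hvw
  have h6 := DFunLike.congr_fun h5 v
  have h7 := DFunLike.congr_fun h5 w
  exact h3 (h1 (h6.symm.trans (hvw.trans h7)))

end Inclusion

section Realizable

variable {n : ℕ} {Ω : TopologicalSpace.Opens (Sph n)} {ρ : Sph n → ℝ}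

lemma conformalFlow_eq (Ω : TopologicalSpace.Opens (Sph n)) (ρ : Sph n → ℝ) (t : ℝ) :
    conformalFlow Ω ρ t = fun p : Ω => (1 / 2 : ℝ) •
      (Real.exp t • coneMap (radialExt ρ) ((p : Sph n) : EuclideanSpace ℝ (Fin (n + 1))) +
        Real.exp (-t) •
          oppConeMap (radialExt ρ) ((p : Sph n) : EuclideanSpace ℝ (Fin (n + 1)))) := by
  funext p
  have h1 : Real.exp (-2 * (ρ p + t)) = Real.exp (-(ρ p + t)) * Real.exp (-(ρ p + t)) := by
    rw [← Real.exp_add]; ring_nf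
  have h2 : Real.exp (ρ p + t) * Real.exp (-(ρ p + t)) = 1 := by
    rw [← Real.exp_add]; simp
  have h3 : Real.exp (ρ p + t) / 2 *
      (1 + Real.exp (-2 * (ρ p + t)) * (1 + ‖sphGrad ρ p‖ ^ 2)) =
      (1 / 2) * (Real.exp (ρ p + t) + Real.exp (-(ρ p + t)) * (1 + ‖sphGrad ρ p‖ ^ 2)) := by
    rw [h1]
    linear_combination (1 / 2) * Real.exp (-(ρ p + t)) * (1 + ‖sphGrad ρ p‖ ^ 2) * h2
  rw [conformalFlow, h3, coneMap, oppConeMap, radialExt_coe, Real.exp_add, neg_add, Real.exp_add]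
  simp only [sphGrad]
  module

lemma inner_eq_tensorP (x : Sph n) {w : EuclideanSpace ℝ (Fin (n + 1))}
    (v : EuclideanSpace ℝ (Fin (n + 1)))
    (hw : inner ℝ (x : EuclideanSpace ℝ (Fin (n + 1))) w = 0) :
    inner ℝ ((‖sphGrad ρ x‖ ^ 2 - 1) • v +
      (2 : ℝ) • fderiv ℝ (gradient (radialExt ρ)) (x : EuclideanSpace ℝ (Fin (n + 1))) v -
      (2 * inner ℝ (sphGrad ρ x) v) • (-(x : EuclideanSpace ℝ (Fin (n + 1))) + sphGrad ρ x)) w =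
      -2 * tensorP ρ x v w := by
  simp only [tensorP, sphHess, inner_add_left, inner_sub_left, inner_neg_left,
    real_inner_smul_left, hw]
  ring

namespace IsRealizable

lemma contDiffAt (hr : IsRealizable Ω ρ) (x : Ω) :
    ContDiffAt ℝ ∞ (radialExt ρ) ((x : Sph n) : EuclideanSpace ℝ (Fin (n + 1))) :=
  contDiffAt_radialExt (hr.smooth.contMDiffAt (Ω.isOpen.mem_nhds x.2))

lemma contMDiff_comp {F : EuclideanSpace ℝ (Fin (n + 1)) → Mink n}
    (hF : ∀ x : Ω, ContDiffAt ℝ ∞ F ((x : Sph n) : EuclideanSpace ℝ (Fin (n + 1)))) :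
    ContMDiff (𝓡 n) 𝓘(ℝ, Mink n) ∞
      (fun x : Ω => F ((x : Sph n) : EuclideanSpace ℝ (Fin (n + 1)))) := fun x =>
  (hF x).contMDiffAt.comp x (contMDiff_incl x)

lemma dMink_coneMap (hr : IsRealizable Ω ρ) (x : Ω) (v : TangentSpace (𝓡 n) x) :
    dMink (fun y : Ω => coneMap (radialExt ρ) ((y : Sph n) : EuclideanSpace ℝ (Fin (n + 1)))) x v =
      Real.exp (ρ x) • ((inner ℝ (sphGrad ρ x) (dIncl Ω x v),
        inner ℝ (sphGrad ρ x) (dIncl Ω x v) • ((x : Sph n) : EuclideanSpace ℝ (Fin (n + 1))) +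
          dIncl Ω x v) : Mink n) := by
  rw [dMink_comp_incl ((contDiffAt_coneMap (hr.contDiffAt x)).differentiableAt (by simp)),
    fderiv_coneMap (hr.contDiffAt x), radialExt_coe]
  rfl

lemma mink_dMink_coneMap (hr : IsRealizable Ω ρ) (x : Ω) (v : TangentSpace (𝓡 n) x) :
    mink (dMink (fun y : Ω => coneMap (radialExt ρ) ((y : Sph n) :
        EuclideanSpace ℝ (Fin (n + 1)))) x v)
      (dMink (fun y : Ω => coneMap (radialExt ρ) ((y : Sph n) :
        EuclideanSpace ℝ (Fin (n + 1)))) x v) = (conformalNorm Ω ρ x v) ^ 2 := by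
  rw [hr.dMink_coneMap, mink_smul_prodMk_self (inner_self_incl x) (inner_dIncl x v),
    real_inner_self_eq_norm_sq, conformalNorm, mul_pow]

lemma inner_sphGrad (hr : IsRealizable Ω ρ) (x : Ω) :
    inner ℝ (sphGrad ρ x) ((x : Sph n) : EuclideanSpace ℝ (Fin (n + 1))) = 0 :=
  inner_gradient_radialExt ((hr.contDiffAt x).differentiableAt (by simp))

/-- The light cone maps of the hypersurface that is associated to a realizable metric. -/
lemma exists_isNullMapPair (hr : IsRealizable Ω ρ) : ∃ ε : ℝ, 0 ≤ ε ∧ IsNullMapPair ε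
    (fun y : Ω => coneMap (radialExt ρ) ((y : Sph n) : EuclideanSpace ℝ (Fin (n + 1))))
    (fun y : Ω => oppConeMap (radialExt ρ) ((y : Sph n) : EuclideanSpace ℝ (Fin (n + 1)))) := by
  obtain ⟨C, hC⟩ := hr.bounded
  have hnull : ∀ x : Ω, IsNullPair
      (coneMap (radialExt ρ) ((x : Sph n) : EuclideanSpace ℝ (Fin (n + 1))))
      (oppConeMap (radialExt ρ) ((x : Sph n) : EuclideanSpace ℝ (Fin (n + 1)))) := fun x =>
    isNullPair_cone (inner_self_incl x) (hr.inner_sphGrad x) (by rw [← Real.exp_add]; simp)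
  have hleft : ∀ x : Ω,
      0 < (coneMap (radialExt ρ) ((x : Sph n) : EuclideanSpace ℝ (Fin (n + 1)))).1 := fun x => by
    simp [coneMap, Real.exp_pos]
  refine ⟨2 * |C|, by positivity, contMDiff_comp fun x => contDiffAt_coneMap (hr.contDiffAt x),
    contMDiff_comp fun x => contDiffAt_oppConeMap (hr.contDiffAt x), hnull, hleft, fun x => ?_,
    fun x v => ?_, fun x => ?_, fun x v => ?_, fun x y hxy => ?_⟩
  · simp only [oppConeMap, Prod.smul_fst, Prod.fst_add, smul_eq_mul, mul_one, mul_zero, add_zero]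
    positivity
  · rw [hr.dMink_coneMap]
    exact mink_smul_prodMk_opp (inner_self_incl x) (inner_dIncl x v) (hr.inner_sphGrad x) _ _
  · rw [injective_iff_map_eq_zero]
    intro v hv
    have h1 := hr.mink_dMink_coneMap x v
    rw [hv, mink_zero_left, eq_comm, sq_eq_zero_iff, conformalNorm] at h1
    have h2 := norm_eq_zero.1 ((mul_eq_zero.1 h1).resolve_left (Real.exp_pos _).ne')
    exact dIncl_injective x (h2.trans (map_zero _).symm)
  · rw [hr.mink_dMink_coneMap,
      dMink_comp_incl ((contDiffAt_oppConeMap (hr.contDiffAt x)).differentiableAt (by simp)),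
      fderiv_oppConeMap (hr.contDiffAt x), radialExt_coe, ← sphGrad]
    set W : EuclideanSpace ℝ (Fin (n + 1)) := (‖sphGrad ρ x‖ ^ 2 - 1) • dIncl Ω x v +
      (2 : ℝ) • fderiv ℝ (gradient (radialExt ρ)) ((x : Sph n) : EuclideanSpace ℝ (Fin (n + 1)))
        (dIncl Ω x v) - (2 * inner ℝ (sphGrad ρ x) (dIncl Ω x v)) •
        (-((x : Sph n) : EuclideanSpace ℝ (Fin (n + 1))) + sphGrad ρ x) with hW
    have hxW : inner ℝ ((x : Sph n) : EuclideanSpace ℝ (Fin (n + 1))) W = 0 := by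
      have h1 := inner_fderiv_gradient_radialExt (v := dIncl Ω x v) (hr.contDiffAt x)
      rw [real_inner_comm, ← sphGrad] at h1
      have h2 := hr.inner_sphGrad x
      rw [real_inner_comm] at h2
      simp only [hW, inner_add_right, inner_sub_right, inner_neg_right, real_inner_smul_right,
        inner_dIncl, inner_self_incl, h1, h2]
      ring
    rw [mink_smul_prodMk_self (inner_self_incl x) hxW, real_inner_self_eq_norm_sq]
    have h1 := inner_eq_tensorP (ρ := ρ) (x : Sph n) (dIncl Ω x v) hxW
    rw [← hW, real_inner_self_eq_norm_sq] at h1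
    have h2 := hC x x.2 (dIncl Ω x v) W (inner_dIncl x v) hxW
    have h3 : ‖W‖ ^ 2 ≤ 2 * C * (Real.exp (ρ x) * ‖dIncl Ω x v‖) * (Real.exp (ρ x) * ‖W‖) := by
      have := neg_abs_le (tensorP ρ x (dIncl Ω x v) W)
      linarith
    have h4 : Real.exp (-ρ x) * Real.exp (ρ x) = 1 := by rw [← Real.exp_add]; simp
    have h5 : ‖W‖ = Real.exp (ρ x) * (Real.exp (-ρ x) * ‖W‖) := by
      linear_combination -‖W‖ * h4
    rw [conformalNorm, ← mul_pow]
    set B := Real.exp (ρ x) * ‖dIncl Ω x v‖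
    set D := Real.exp (-ρ x) * ‖W‖
    have h6 : D ^ 2 ≤ 2 * C * B * D := by
      have h7 : 0 < Real.exp (ρ x) ^ 2 := by positivity
      rw [h5] at h3
      refine le_of_mul_le_mul_left ?_ h7
      linarith
    have h8 : (2 * |C|) ^ 2 * B ^ 2 = (2 * C * B) ^ 2 := by
      rw [mul_pow, sq_abs]; ring
    rw [h8]
    nlinarith [sq_nonneg (2 * C * B - D)]
  · have h1 := eq_smul_of_null (hnull x).left (hleft x) (hnull y).left (hleft y) hxy
    have h2 : inner ℝ ((x : Sph n) : EuclideanSpace ℝ (Fin (n + 1)))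
        ((y : Sph n) : EuclideanSpace ℝ (Fin (n + 1))) = 1 := by
      rw [coneMap, coneMap, mink_smul_left, mink_smul_right, mul_eq_zero, mul_eq_zero] at hxy
      have := (hxy.resolve_left (Real.exp_pos _).ne').resolve_left (Real.exp_pos _).ne'
      simp only [mink] at this
      linarith
    exact Subtype.ext (Subtype.ext ((inner_eq_one_iff_of_norm_eq_one
      (norm_eq_of_mem_sphere _) (norm_eq_of_mem_sphere _)).1 h2))

end IsRealizable

theorem exists_isEmbeddedHyp_conformalFlow (hn : 1 ≤ n) (hr : IsRealizable Ω ρ) :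
    ∃ t₀ : ℝ, ∀ t ≥ t₀, IsEmbeddedHyp (conformalFlow Ω ρ t) := by
  obtain ⟨ε, hε, hpair⟩ := hr.exists_isNullMapPair
  simp only [conformalFlow_eq]
  refine hpair.exists_isEmbeddedHyp hn ⟨conformalNorm Ω ρ, 1, hr.complete, zero_le_one,
    fun p c v => ?_, fun p v => ?_⟩ hε
  · rw [conformalNorm, map_smul, norm_smul, Real.norm_eq_abs, conformalNorm]
    ring
  · rw [hr.mink_dMink_coneMap, one_mul]
    exact Real.le_sqrt_of_sq_le le_rfl

end Realizable
end HypFlow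
end

theorem theorem1p3 (n : ℕ) (hn : 2 ≤ n) :
    (∀ (M : Type*) [TopologicalSpace M] [ChartedSpace (EuclideanSpace ℝ (Fin n)) M]
      [IsManifold (𝓡 n) ∞ M] [T2Space M] [SecondCountableTopology M]
      (φ η : M → HypFlow.Mink n),
      HypFlow.IsImmersedHyp φ →
      HypFlow.IsUnitNormal φ η →
      HypFlow.IsCompleteMetric (HypFlow.inducedNorm φ) →
      HypFlow.IsUniformlyWeaklyHoroConvex φ η →
      Function.Injective (HypFlow.gaussMap φ η) →
      HypFlow.IsFiniteUnionOfClosedSubmanifolds (HypFlow.boundaryAtInfinity φ) →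
      ∃ t₀ : ℝ, ∀ t ≥ t₀, HypFlow.IsEmbeddedHyp (HypFlow.normalFlow φ η t)) ∧
    (∀ (Ω : TopologicalSpace.Opens (HypFlow.Sph n)) (ρ : HypFlow.Sph n → ℝ),
      HypFlow.IsRealizable Ω ρ →
      HypFlow.IsFiniteUnionOfClosedSubmanifolds (frontier (Ω : Set (HypFlow.Sph n))) →
      ∃ t₀ : ℝ, ∀ t ≥ t₀, HypFlow.IsEmbeddedHyp (HypFlow.conformalFlow Ω ρ t)) := by
  exact ⟨fun _ _ _ _ _ _ _ _ hφ hη hcomp hκ hG _ =>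
      HypFlow.exists_isEmbeddedHyp_normalFlow (by omega) hφ hη hcomp hκ hG,
    fun _ _ hr _ => HypFlow.exists_isEmbeddedHyp_conformalFlow (by omega) hr⟩
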